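/- A sign pattern of order $n$ is a matrix $\mathcal P=[p_{ij}]$ with entries in $\{+,-,0\}$; its qualitative class $\mathcal Q(\mathcal P)$ is the set of all real $n\times n$ matrices $A=[a_{ij}]$ with $\operatorname{sgn}(a_{ij})=p_{ij}$ for all $i,j$. The pattern $\mathcal P$ is \emph{consistent} if there is an integer $k$ with $0\le k\le n$ such that every $A\in\mathcal Q(\mathcal P)$ has exactly $k$ real eigenvalues, counted with algebraic multiplicity. It is \emph{combinatorially symmetric} if $p_{ij}\neq 0\iff p_{ji}\ne 0$. For such a pattern with zero diagonal, the underlying signed undirected graph $G$ has vertex set $\{1,\dots,n\}$ and an edge $\{i,j\}$ whenever $p_{ij}\neq 0$; this edge is positive if $p_{ij}p_{ji}=+$ and negative if $p_{ij}p_{ji}=-$. Let $\mathcal P$ be an irreducible, combinatorially symmetric sign pattern of order $n$ with zero diagonal. Suppose that $G$ has exactly one cycle $\mathcal C=u_1u_2\cdots u_k$ (with $k\ge 3$), and that for every leaf (vertex of degree one) $x$ of $G$ the distance $\operatorname{dist}(x,\mathcal C)=\min_i \operatorname{dist}(x,u_i)$ is even. A \emph{maximal signed path} of $\mathcal C$ is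 a path of positive length formed by edges of $\mathcal C$, all of the same sign, such that every edge of $\mathcal C$ that is not in the path but shares a vertex with it has the opposite sign (so there is none if all edges of $\mathcal C$ have the same sign); a path and its reverse are regarded as the same path. Then $\mathcal P$ is not consistent if any one of the following holds. (i) $\mathcal C$ has two positive edges with no common vertex. (ii) $\mathcal C$ has more than one maximal signed path of odd length. (iii) $k$ is odd and $\mathcal C$ has a positive edge. -/

import Mathlib

/-- An `n × n` sign pattern: a matrix with entries in `{+, -, 0}`. -/
abbrev SignPattern (n : ℕ) := Matrix (Fin n) (Fin n) SignType

namespace SignPattern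

variable {n : ℕ}

/-- The qualitative class of `P`: all real matrices whose entries have the signs given by `P`. -/
def qualitativeClass (P : SignPattern n) : Set (Matrix (Fin n) (Fin n) ℝ) :=
  {A | ∀ i j, SignType.sign (A i j) = P i j}

/-- The number of real eigenvalues of a real matrix, counted with algebraic multiplicity. -/
noncomputable def numRealEigenvalues (A : Matrix (Fin n) (Fin n) ℝ) : ℕ :=
  Multiset.card A.charpoly.roots

/-- `P` is `k`-consistent: every matrix in the qualitative class has exactly `k` real
eigenvalues. -/
def IsKConsistent (P : SignPattern n) (k : ℕ) : Prop :=
  ∀ A ∈ P.qualitativeClass, numRealEigenvalues A = k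

/-- `P` is consistent: it is `k`-consistent for some `0 ≤ k ≤ n`. -/
def IsConsistent (P : SignPattern n) : Prop :=
  ∃ k, k ≤ n ∧ P.IsKConsistent k

/-- `P` is irreducible: it is not permutation similar to a block triangular pattern, that is,
no nonempty proper set `S` of indices has `P i j = 0` for all `i ∈ S` and `j ∉ S`. -/
def IsIrreducible (P : SignPattern n) : Prop :=
  ∀ S : Finset (Fin n), S.Nonempty → S ≠ Finset.univ → ∃ i ∈ S, ∃ j ∉ S, P i j ≠ 0

/-- `P` is combinatorially symmetric. -/
def IsCombSymmetric (P : SignPattern n) : Prop :=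
  ∀ i j, P i j ≠ 0 ↔ P j i ≠ 0

/-- `P` has a zero diagonal. -/
def IsZeroDiagonal (P : SignPattern n) : Prop :=
  ∀ i, P i i = 0

/-- The underlying undirected graph of `P`: the edges are the pairs `{i, j}` with
`p_ij p_ji ≠ 0`. -/
def graph (P : SignPattern n) : SimpleGraph (Fin n) where
  Adj i j := i ≠ j ∧ P i j * P j i ≠ 0
  symm := ⟨fun i j h => ⟨h.1.symm, by rw [mul_comm]; exact h.2⟩⟩
  loopless := ⟨fun _ h => h.1 rfl⟩

/-- The sign `p_ij p_ji` of the edge `{i, j}`. -/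
def edgeSign (P : SignPattern n) : Sym2 (Fin n) → SignType :=
  Sym2.lift ⟨fun i j => P i j * P j i, fun i j => mul_comm (P i j) (P j i)⟩

/-- The closed walk `c` is a cycle, and it is the only one: every cycle of the graph has the same
edges as `c`. -/
def IsOnlyCycle {V : Type*} {G : SimpleGraph V} {v : V} (c : G.Walk v v) : Prop :=
  c.IsCycle ∧ ∀ (w : V) (d : G.Walk w w), d.IsCycle → ∀ e, e ∈ d.edges ↔ e ∈ c.edges

/-- A leaf: a vertex with exactly one neighbour. -/
def IsLeaf {V : Type*} (G : SimpleGraph V) (x : V) : Prop :=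
  ∃! y, G.Adj x y

/-- The distance from the vertex `x` to `c`: the minimum of the distances from `x` to the vertices
of `c`. -/
noncomputable def distTo {V : Type*} {G : SimpleGraph V} {v : V} (c : G.Walk v v) (x : V) : ℕ :=
  sInf {d | ∃ y ∈ c.support, d = G.dist x y}

/-- `p` is a maximal signed path of the cycle `c`: a path of positive length along `c`, all of
whose edges have the same sign `σ`, such that every further edge of `c` that meets `p` has the
other sign. (A cycle all of whose edges have the same sign has no such path.) -/
def IsMaximalSignedPath (P : SignPattern n) {v : Fin n} (c : P.graph.Walk v v)
    {a b : Fin n} (p : P.graph.Walk a b) : Prop :=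
  p.IsPath ∧ 0 < p.length ∧ (∀ e ∈ p.edges, e ∈ c.edges) ∧
    ∃ σ : SignType, (∀ e ∈ p.edges, P.edgeSign e = σ) ∧
      ∀ e ∈ c.edges, e ∉ p.edges → (∃ x ∈ p.support, x ∈ e) → P.edgeSign e ≠ σ

/-- `c` has two nonadjacent positive edges. -/
def HasTwoNonadjacentPosEdges (P : SignPattern n) {v : Fin n} (c : P.graph.Walk v v) : Prop :=
  ∃ e ∈ c.edges, ∃ f ∈ c.edges,
    (∀ x, ¬ (x ∈ e ∧ x ∈ f)) ∧ P.edgeSign e = 1 ∧ P.edgeSign f = 1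

/-- `c` has more than one maximal signed path of odd length; two paths are distinct when their
edge sets are, so that a path is identified with its reverse. -/
def HasTwoOddMaximalSignedPaths (P : SignPattern n) {v : Fin n} (c : P.graph.Walk v v) : Prop :=
  ∃ (a b a' b' : Fin n) (p : P.graph.Walk a b) (q : P.graph.Walk a' b'),
    P.IsMaximalSignedPath c p ∧ P.IsMaximalSignedPath c q ∧ Odd p.length ∧ Odd q.length ∧
      ¬ ∀ e, e ∈ p.edges ↔ e ∈ q.edges

/-- `c` has a positive edge. -/
def HasPosEdge (P : SignPattern n) {v : Fin n} (c : P.graph.Walk v v) : Prop :=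
  ∃ e ∈ c.edges, P.edgeSign e = 1

end SignPattern

/-! Let `O` be the set of vertices at odd distance from the cycle. Off the cycle the graph is a
forest: each vertex has one neighbour nearer the cycle and its other neighbours are farther. A
vertex of `O` is not a leaf, so it can be matched to a farther neighbour. These edges form a
matching disjoint from the cycle, and every edge of `G` either meets `O` or lies between two cycle
vertices. Let `q` be the number of negative matching edges.

Two matrices of the class with different numbers of real eigenvalues are obtained by perturbing
sparse ones.

Many real: the nonzero entries of any matrix of the class lie in the rows of `O` and the cycle or in
the columns of `O`, so `0` has multiplicity at least `n - 2|O| - k`. Adding `r` disjoint positive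
cycle edges to the matching, each positive edge contributes a pair of simple real eigenvalues that
survives perturbation. This gives at least `n - k - 2q + 2r` real eigenvalues (`exists_many_real`).

Few real: distinct nonreal eigenvalues stay nonreal. A directed cycle has the `k`-th roots of `1` or
`-1` as eigenvalues, at most two of them real, and one if `k` is odd. With the negative matching
edges, at most `n - k - 2q + 2` real eigenvalues remain (`+ 1` for odd `k`)
(`exists_numRealEigenvalues_cycle_le`).

Taking `r = 2` gives (i), and `r = 1` gives (iii). For (ii), an odd maximal signed path forces a
positive edge. If `k` is even, then either (i) applies or the cycle has a perfect matching of
negative edges. In the latter case `exists_few_real` gives at most `n - k - 2q` real eigenvalues,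
against `r = 1`. -/

open Polynomial Filter Topology

namespace SignPattern

/-! ### Multiplicity of zero and persistence of eigenvalues under perturbation. -/

section Perturbation

variable {V : Type*} [Fintype V] [DecidableEq V]

/-- If every nonzero entry of `A` lies in a row of `I` or in a column of `J`, then the algebraic
multiplicity of the eigenvalue `0` is at least `|V| - |I| - |J|`. -/
theorem card_le_rootMultiplicity_zero_add {K : Type*} [Field K] (A : Matrix V V K)
    (I J : Finset V) (h : ∀ i j, A i j ≠ 0 → i ∈ I ∨ j ∈ J) :
    Fintype.card V ≤ A.charpoly.rootMultiplicity 0 + (I.card + J.card) := by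
  let L : (V → K) →ₗ[K] (I → K) × (J → K) :=
    LinearMap.prod ((LinearMap.funLeft K K (Subtype.val : I → V)).comp A.mulVecLin)
      (LinearMap.funLeft K K (Subtype.val : J → V))
  have hker : LinearMap.ker L ≤ Module.End.eigenspace (Matrix.toLin' A) 0 := by
    intro v hv
    rw [LinearMap.mem_ker] at hv
    have h1 : ∀ i ∈ I, A.mulVec v i = 0 := fun i hi => congrFun (congrArg Prod.fst hv) ⟨i, hi⟩
    have h2 : ∀ j ∈ J, v j = 0 := fun j hj => congrFun (congrArg Prod.snd hv) ⟨j, hj⟩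
    rw [Module.End.mem_eigenspace_iff, Matrix.toLin'_apply, zero_smul]
    funext i
    by_cases hi : i ∈ I
    · exact h1 i hi
    · refine Finset.sum_eq_zero fun j _ => ?_
      by_cases hA : A i j = 0
      · simp [hA]
      · simp [h2 j ((h i j hA).resolve_left hi)]
  have h1 := LinearMap.finrank_range_add_finrank_ker L
  have h2 := Submodule.finrank_le (LinearMap.range L)
  have h3 := Submodule.finrank_mono hker
  have h4 := LinearMap.finrank_eigenspace_le (Matrix.toLin' A) (0 : K)
  rw [Matrix.charpoly_toLin'] at h4
  simp only [Module.finrank_prod, Module.finrank_fintype_fun_eq_card, Fintype.card_coe] at h1 h2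
  omega

theorem isRoot_charpoly_of_mulVec_eq {K : Type*} [Field K] (A : Matrix V V K) (v : V → K)
    (hv : v ≠ 0) (μ : K) (h : A.mulVec v = μ • v) : A.charpoly.IsRoot μ := by
  rw [← Matrix.charpoly_toLin', ← Module.End.hasEigenvalue_iff_isRoot_charpoly]
  exact Module.End.hasEigenvalue_of_hasEigenvector (x := v)
    ⟨Module.End.mem_eigenspace_iff.2 (by simpa using h), hv⟩

/-- For monic `p`, `‖p.eval w‖` is the product of the distances from `w` to the roots. -/
theorem exists_root_norm_sub_lt (p : ℂ[X]) (hp : p.Monic) {ε : ℝ} (hε : 0 < ε) (w : ℂ)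
    (h : ‖p.eval w‖ < ε ^ p.natDegree) : ∃ z ∈ p.roots, ‖w - z‖ < ε := by
  by_contra! hcon
  have hs := IsAlgClosed.splits p
  have key : ∀ s : Multiset ℂ, (∀ z ∈ s, ε ≤ ‖w - z‖) →
      ε ^ Multiset.card s ≤ ‖(s.map fun z => w - z).prod‖ := by
    intro s
    induction s using Multiset.induction_on with
    | empty => simp
    | cons a s ih =>
      intro hs
      rw [Multiset.map_cons, Multiset.prod_cons, norm_mul, Multiset.card_cons, pow_succ']
      exact mul_le_mul (hs a (by simp)) (ih fun z hz => hs z (by simp [hz])) (by positivity)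
        (norm_nonneg _)
  have h2 := key p.roots hcon
  rw [← hs.natDegree_eq_card_roots] at h2
  have h3 : p.eval w = (p.roots.map fun z => w - z).prod := by
    conv_lhs => rw [hs.eq_prod_roots_of_monic hp]
    rw [eval_multiset_prod, Multiset.map_map]
    simp
  rw [h3] at h
  linarith

theorem tendsto_eval_charpoly {K : Type*} [NormedField K] (B E : Matrix V V K) (w : K) :
    Tendsto (fun t : K => (B + t • E).charpoly.eval w) (𝓝 0) (𝓝 (B.charpoly.eval w)) := by
  have hc : Continuous fun t : K => (B + t • E).charpoly.eval w := by
    simp only [Matrix.eval_charpoly]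
    fun_prop
  simpa using hc.tendsto 0

/-- Disjoint discs around the points of `S`, all missing the real axis, each keep a root of the
perturbed polynomial. These roots are distinct and nonreal, so they and the real roots together are
at most the degree. -/
theorem eventually_card_roots_add_le (B E : Matrix V V ℝ) (S : Finset ℂ)
    (hS : ∀ w ∈ S, w.im ≠ 0 ∧ (B.map Complex.ofRealHom).charpoly.IsRoot w) :
    ∀ᶠ t : ℝ in 𝓝 0, Multiset.card (B + t • E).charpoly.roots + S.card ≤ Fintype.card V := by
  classical
  obtain ⟨ε, hε, him, hdist⟩ : ∃ ε > 0, (∀ w ∈ S, ε < |w.im|) ∧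
      ∀ w ∈ S, ∀ z ∈ S, w ≠ z → 2 * ε < ‖w - z‖ := by
    have h1 : ∀ᶠ ε : ℝ in 𝓝[>] 0, ∀ w ∈ S, ε < |w.im| :=
      (Filter.eventually_all_finset S).2 fun w hw =>
        nhdsWithin_le_nhds (Iio_mem_nhds (abs_pos.2 (hS w hw).1))
    have h2 : ∀ᶠ ε : ℝ in 𝓝[>] 0, ∀ w ∈ S, ∀ z ∈ S, w ≠ z → 2 * ε < ‖w - z‖ := by
      refine (Filter.eventually_all_finset S).2 fun w hw =>
        (Filter.eventually_all_finset S).2 fun z hz => ?_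
      by_cases hwz : w = z
      · simp [hwz]
      · have : ∀ᶠ ε : ℝ in 𝓝 0, ε < ‖w - z‖ / 2 :=
          Iio_mem_nhds (by have := norm_pos_iff.2 (sub_ne_zero.2 hwz); positivity)
        filter_upwards [nhdsWithin_le_nhds this] with ε hε _
        linarith
    obtain ⟨ε, ⟨h1, h2⟩, h3⟩ := ((h1.and h2).and self_mem_nhdsWithin).exists
    exact ⟨ε, h3, h1, h2⟩
  have hev : ∀ᶠ t : ℝ in 𝓝 0, ∀ w ∈ S,
      ‖((B + t • E).map Complex.ofRealHom).charpoly.eval w‖ < ε ^ Fintype.card V := by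
    refine (Filter.eventually_all_finset S).2 fun w hw => ?_
    have h0 := tendsto_eval_charpoly (B.map Complex.ofRealHom) (E.map Complex.ofRealHom) w
    rw [(hS w hw).2] at h0
    have h1 : Tendsto (fun t : ℝ => (t : ℂ)) (𝓝 0) (𝓝 0) := by
      simpa using (Complex.continuous_ofReal.tendsto 0)
    have h2 := (h0.comp h1).norm
    rw [norm_zero] at h2
    have h3 := h2.eventually (Iio_mem_nhds (show (0 : ℝ) < ε ^ Fintype.card V by positivity))
    filter_upwards [h3] with t ht
    have : (B + t • E).map Complex.ofRealHom =
        B.map Complex.ofRealHom + (t : ℂ) • E.map Complex.ofRealHom := by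
      ext i j; simp
    rw [this]
    exact ht
  filter_upwards [hev] with t ht
  set A := B + t • E with hA
  set q := (A.map Complex.ofRealHom).charpoly with hq
  have hqm : q.Monic := Matrix.charpoly_monic _
  have hqd : q.natDegree = Fintype.card V := Matrix.charpoly_natDegree_eq_dim _
  have hqmap : q = A.charpoly.map Complex.ofRealHom := by rw [hq, Matrix.charpoly_map]
  have hz : ∀ w ∈ S, ∃ z ∈ q.roots, ‖w - z‖ < ε := fun w hw =>
    exists_root_norm_sub_lt q hqm hε w (by rw [hqd]; exact ht w hw)
  choose! z hzr hzn using hz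
  have hinj : Set.InjOn z S := by
    intro w hw w' hw' heq
    by_contra hne
    have h1 := hdist w hw w' hw' hne
    have h2 : ‖w - w'‖ ≤ ‖w - z w‖ + ‖w' - z w'‖ := by
      rw [← norm_neg (w' - z w')]
      refine le_trans (le_of_eq ?_) (norm_add_le _ _)
      rw [heq]; congr 1; ring
    linarith [hzn w hw, hzn w' hw']
  have hzim : ∀ w ∈ S, (z w).im ≠ 0 := by
    intro w hw h0
    have h1 := Complex.abs_im_le_norm (w - z w)
    rw [Complex.sub_im, h0, sub_zero] at h1
    linarith [him w hw, hzn w hw]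
  have hle1 : (A.charpoly.roots.map Complex.ofRealHom) ≤ q.roots.filter (fun x => x.im = 0) := by
    rw [Multiset.le_filter]
    refine ⟨hqmap ▸ Polynomial.map_roots_le (hqmap ▸ hqm.ne_zero), ?_⟩
    intro x hx
    obtain ⟨r, -, rfl⟩ := Multiset.mem_map.1 hx
    simp
  have hle2 : (S.image z).val ≤ q.roots.filter (fun x => ¬ x.im = 0) := by
    rw [Multiset.le_filter, Multiset.le_iff_subset (S.image z).nodup]
    constructor
    · intro x hx
      obtain ⟨w, hw, rfl⟩ := Finset.mem_image.1 hx
      exact hzr w hw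
    · intro x hx
      obtain ⟨w, hw, rfl⟩ := Finset.mem_image.1 hx
      exact hzim w hw
  have hc1 := Multiset.card_le_card hle1
  have hc2 := Multiset.card_le_card hle2
  have hc3 := congrArg Multiset.card (Multiset.filter_add_not (fun x : ℂ => x.im = 0) q.roots)
  have hc4 := q.card_roots'
  rw [Multiset.card_map] at hc1
  rw [Finset.card_val, Finset.card_image_of_injOn hinj] at hc2
  rw [Multiset.card_add] at hc3
  omega

/-- The root `0` with its multiplicity and one copy of each point of `S` already fill the degree, so
a second copy of `w` would be one root too many. -/
theorem rootMultiplicity_eq_one_of_card_le (q : ℂ[X]) (hq : q ≠ 0) (S : Finset ℂ)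
    (hS : ∀ w ∈ S, w ≠ 0 ∧ q.IsRoot w)
    (hcard : q.natDegree ≤ q.rootMultiplicity 0 + S.card) (w : ℂ) (hw : w ∈ S) :
    q.rootMultiplicity w = 1 := by
  classical
  have hpos : 0 < q.rootMultiplicity w := (rootMultiplicity_pos hq).2 (hS w hw).2
  by_contra hne
  have hle : w ::ₘ (Multiset.replicate (q.rootMultiplicity 0) 0 + S.val) ≤ q.roots := by
    rw [Multiset.le_iff_count]
    intro x
    rw [Multiset.count_cons, Multiset.count_add, Multiset.count_replicate, count_roots]
    have hS0 : (0 : ℂ) ∉ S := fun h => (hS 0 h).1 rfl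
    have hcount := Multiset.nodup_iff_count_le_one.1 S.nodup x
    by_cases hx0 : x = 0
    · subst hx0
      rw [Multiset.count_eq_zero_of_notMem (by simpa using hS0)]
      simp [(hS w hw).1.symm]
    · rw [if_neg (Ne.symm hx0)]
      by_cases hxw : x = w
      · subst hxw
        simp
        omega
      · rw [if_neg hxw]
        by_cases hxS : x ∈ S
        · have := (rootMultiplicity_pos hq).2 (hS x hxS).2
          omega
        · rw [Multiset.count_eq_zero_of_notMem (by simpa using hxS)]
          simp
  have h1 := Multiset.card_le_card hle
  have h2 := q.card_roots'
  simp at h1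
  omega

theorem eventually_eval_sub_mul_eval_add_neg (p : ℝ[X]) (s : ℝ)
    (hs : p.rootMultiplicity s = 1) :
    ∀ᶠ ε : ℝ in 𝓝[>] 0, p.eval (s - ε) * p.eval (s + ε) < 0 := by
  have hp : p ≠ 0 := by rintro rfl; simp at hs
  obtain ⟨q, hq, hndvd⟩ := exists_eq_pow_rootMultiplicity_mul_and_not_dvd p hp s
  rw [hs, pow_one] at hq
  have hqs : q.eval s ≠ 0 := fun h => hndvd (dvd_iff_isRoot.2 h)
  have hcont : Tendsto (fun ε : ℝ => q.eval (s - ε) * q.eval (s + ε)) (𝓝[>] 0)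
      (𝓝 (q.eval s * q.eval s)) := by
    have : Continuous fun ε : ℝ => q.eval (s - ε) * q.eval (s + ε) := by fun_prop
    simpa using (this.tendsto 0).mono_left nhdsWithin_le_nhds
  filter_upwards [hcont.eventually (Ioi_mem_nhds (mul_self_pos.2 hqs)), self_mem_nhdsWithin]
    with ε h1 h2
  rw [hq]
  simp only [eval_mul, eval_sub, eval_X, eval_C]
  have h3 : (0 : ℝ) < ε := h2
  have h4 : 0 < q.eval (s - ε) * q.eval (s + ε) := h1
  nlinarith [mul_pos (mul_pos h3 h3) h4]

theorem exists_root_of_eval_mul_eval_neg (p : ℝ[X]) {a b : ℝ} (hab : a ≤ b)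
    (h : p.eval a * p.eval b < 0) : ∃ x ∈ Set.Ioo a b, p.IsRoot x := by
  rcases mul_neg_iff.1 h with h | h
  · obtain ⟨x, hx, hx0⟩ := intermediate_value_Ioo' hab p.continuousOn ⟨h.2, h.1⟩
    exact ⟨x, hx, hx0⟩
  · obtain ⟨x, hx, hx0⟩ := intermediate_value_Ioo hab p.continuousOn h
    exact ⟨x, hx, hx0⟩

/-- A simple real root is a sign change, which survives perturbation; a double one could leave the
real axis. The intervals are disjoint and miss `0`, so the new roots are distinct and nonzero. -/
theorem eventually_exists_roots (B E : Matrix V V ℝ) (S : Finset ℝ)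
    (hS : ∀ s ∈ S, s ≠ 0 ∧ B.charpoly.rootMultiplicity s = 1) :
    ∀ᶠ t : ℝ in 𝓝 0, ∃ S' : Finset ℝ, S'.card = S.card ∧
      ∀ s ∈ S', s ≠ 0 ∧ (B + t • E).charpoly.IsRoot s := by
  classical
  obtain ⟨ε, hε, hnz, hdist, hneg⟩ : ∃ ε > 0, (∀ s ∈ S, ε < |s|) ∧
      (∀ s ∈ S, ∀ r ∈ S, s ≠ r → 2 * ε < |s - r|) ∧
      ∀ s ∈ S, B.charpoly.eval (s - ε) * B.charpoly.eval (s + ε) < 0 := by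
    have h1 : ∀ᶠ ε : ℝ in 𝓝[>] 0, ∀ s ∈ S, ε < |s| :=
      (Filter.eventually_all_finset S).2 fun s hs =>
        nhdsWithin_le_nhds (Iio_mem_nhds (abs_pos.2 (hS s hs).1))
    have h2 : ∀ᶠ ε : ℝ in 𝓝[>] 0, ∀ s ∈ S, ∀ r ∈ S, s ≠ r → 2 * ε < |s - r| := by
      refine (Filter.eventually_all_finset S).2 fun s hs =>
        (Filter.eventually_all_finset S).2 fun r hr => ?_
      by_cases hsr : s = r
      · simp [hsr]
      · have : ∀ᶠ ε : ℝ in 𝓝 0, ε < |s - r| / 2 :=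
          Iio_mem_nhds (by have := abs_pos.2 (sub_ne_zero.2 hsr); positivity)
        filter_upwards [nhdsWithin_le_nhds this] with ε hε _
        linarith
    have h3 : ∀ᶠ ε : ℝ in 𝓝[>] 0, ∀ s ∈ S,
        B.charpoly.eval (s - ε) * B.charpoly.eval (s + ε) < 0 :=
      (Filter.eventually_all_finset S).2 fun s hs =>
        eventually_eval_sub_mul_eval_add_neg _ s (hS s hs).2
    obtain ⟨ε, ⟨⟨h1, h2⟩, h3⟩, h4⟩ := (((h1.and h2).and h3).and self_mem_nhdsWithin).exists
    exact ⟨ε, h4, h1, h2, h3⟩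
  have hev : ∀ᶠ t : ℝ in 𝓝 0, ∀ s ∈ S,
      (B + t • E).charpoly.eval (s - ε) * (B + t • E).charpoly.eval (s + ε) < 0 :=
    (Filter.eventually_all_finset S).2 fun s hs =>
      ((tendsto_eval_charpoly B E (s - ε)).mul (tendsto_eval_charpoly B E (s + ε))).eventually
        (Iio_mem_nhds (hneg s hs))
  filter_upwards [hev] with t ht
  have hx : ∀ s ∈ S, ∃ x ∈ Set.Ioo (s - ε) (s + ε), (B + t • E).charpoly.IsRoot x := fun s hs =>
    exists_root_of_eval_mul_eval_neg _ (by linarith) (ht s hs)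
  choose! x hxm hxr using hx
  refine ⟨S.image x, Finset.card_image_of_injOn ?_, ?_⟩
  · intro s hs r hr heq
    by_contra hne
    have h1 := hdist s hs r hr hne
    have h2 := hxm s hs
    have h3 := hxm r hr
    rw [heq] at h2
    rcases abs_cases (s - r) with h | h <;> linarith [h2.1, h2.2, h3.1, h3.2]
  · intro y hy
    obtain ⟨s, hs, rfl⟩ := Finset.mem_image.1 hy
    refine ⟨fun h0 => ?_, hxr s hs⟩
    have h1 := hnz s hs
    have h2 := hxm s hs
    rw [h0] at h2
    rcases abs_cases s with h | h <;> linarith [h2.1, h2.2]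

theorem rootMultiplicity_zero_add_card_le (p : ℝ[X]) (hp : p ≠ 0) (S : Finset ℝ)
    (hS : ∀ s ∈ S, s ≠ 0 ∧ p.IsRoot s) :
    p.rootMultiplicity 0 + S.card ≤ Multiset.card p.roots := by
  classical
  have h1 : Multiset.replicate (p.rootMultiplicity 0) 0 ≤ p.roots.filter (fun x => x = 0) := by
    rw [Multiset.le_filter, ← Multiset.le_count_iff_replicate_le, count_roots]
    exact ⟨le_rfl, fun a ha => Multiset.eq_of_mem_replicate ha⟩
  have h2 : S.val ≤ p.roots.filter (fun x => ¬ x = 0) := by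
    rw [Multiset.le_filter, Multiset.le_iff_subset S.nodup]
    exact ⟨fun s hs => (mem_roots hp).2 (hS s hs).2, fun s hs => (hS s hs).1⟩
  have hc1 := Multiset.card_le_card h1
  have hc2 := Multiset.card_le_card h2
  have hc3 := congrArg Multiset.card (Multiset.filter_add_not (fun x : ℝ => x = 0) p.roots)
  rw [Multiset.card_replicate] at hc1
  rw [Finset.card_val] at hc2
  rw [Multiset.card_add] at hc3
  omega

end Perturbation

/-! ### Eigenvalues of matching matrices. -/

variable {n : ℕ}

/-- The coordinates `x`, `y` span an invariant plane on which `M` has zero diagonal, with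
eigenvector `(M x y, μ)`. -/
theorem isRoot_charpoly_of_isolated_pair {V K : Type*} [Fintype V] [DecidableEq V] [Field K]
    (M : Matrix V V K) {x y : V} (hxy : x ≠ y) (hx : ∀ i, i ≠ y → M i x = 0)
    (hy : ∀ i, i ≠ x → M i y = 0) (hne : M x y ≠ 0) (μ : K) (hμ : μ ^ 2 = M x y * M y x) :
    M.charpoly.IsRoot μ := by
  refine isRoot_charpoly_of_mulVec_eq M (Pi.single x (M x y) + Pi.single y μ) ?_ μ ?_
  · intro h
    have := congrFun h x
    simp [hxy] at this
    exact hne this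
  · funext i
    rw [Matrix.mulVec_add, Matrix.mulVec_single, Matrix.mulVec_single]
    simp only [Pi.add_apply, Pi.smul_apply, Matrix.col_apply, MulOpposite.smul_eq_mul_unop,
      MulOpposite.unop_op, smul_eq_mul]
    by_cases hix : i = x
    · subst hix
      simp [hx i hxy, hxy]
      ring
    · by_cases hiy : i = y
      · subst hiy
        simp [hy i hix, hix]
        linear_combination -hμ
      · simp [hx i hiy, hy i hix, hix, hiy]

/-- `I` and `m` describe a matching of `G`: the edges `{x, m x}` with `x ∈ I` are pairwise
disjoint. -/
structure IsMatchingMap {V : Type*} (G : SimpleGraph V) (I : Finset V) (m : V → V) : Prop where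
  adj : ∀ x ∈ I, G.Adj x (m x)
  injOn : Set.InjOn m I
  notMem : ∀ x ∈ I, m x ∉ I

/-- `B` has the signs of `P`, except that some entries may vanish. -/
def IsSubordinate (P : SignPattern n) (B : Matrix (Fin n) (Fin n) ℝ) : Prop :=
  ∀ i j, B i j = 0 ∨ SignType.sign (B i j) = P i j

theorem sign_cast_real (s : SignType) : SignType.sign (s : ℝ) = s := by
  cases s <;> simp

/-- The perturbation fills the vanishing entries with the right signs and only reinforces the
others. -/
theorem IsSubordinate.add_smul_mem {P : SignPattern n} {B : Matrix (Fin n) (Fin n) ℝ}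
    (hB : P.IsSubordinate B) {t : ℝ} (ht : 0 < t) :
    B + t • P.map (fun s : SignType => (s : ℝ)) ∈ P.qualitativeClass := by
  intro i j
  have h1 : SignType.sign (t * (P i j : ℝ)) = P i j := by
    rw [sign_mul, sign_pos ht, one_mul, sign_cast_real]
  simp only [Matrix.add_apply, Matrix.smul_apply, Matrix.map_apply, smul_eq_mul]
  rcases hB i j with h | h
  · rw [h, zero_add, h1]
  · rcases SignType.trichotomy (P i j) with hP | hP | hP <;> rw [hP] at h <;> rw [hP]
    · rw [sign_eq_neg_one_iff] at h ⊢
      simp only [SignType.coe_neg_one]; linarith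
    · rw [sign_eq_zero_iff] at h ⊢
      simp [h]
    · rw [sign_eq_one_iff] at h ⊢
      simp only [SignType.coe_one]; linarith

theorem edgeSign_mk (P : SignPattern n) (x y : Fin n) : P.edgeSign s(x, y) = P x y * P y x := rfl

theorem edgeSign_eq_of_adj (P : SignPattern n) {x y : Fin n} (h : P.graph.Adj x y) :
    P.edgeSign s(x, y) = 1 ∨ P.edgeSign s(x, y) = -1 := by
  rw [edgeSign_mk]
  rcases SignType.trichotomy (P x y * P y x) with h' | h' | h'
  · exact Or.inr h'
  · exact absurd h' h.2
  · exact Or.inl h'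

/-- The matrix supported on the edges of a matching, the edge at `x` having weight `x + 2`. -/
noncomputable def matchingMatrix (P : SignPattern n) (I : Finset (Fin n)) (m : Fin n → Fin n) :
    Matrix (Fin n) (Fin n) ℝ := fun i j =>
  if i ∈ I ∧ j = m i then ((i : ℝ) + 2) * (P i j : ℝ) else
    if j ∈ I ∧ i = m j then (P i j : ℝ) else 0

theorem matchingMatrix_subordinate (P : SignPattern n) (I : Finset (Fin n))
    (m : Fin n → Fin n) : P.IsSubordinate (matchingMatrix P I m) := by
  intro i j
  unfold matchingMatrix
  split_ifs
  · right
    rw [sign_mul, sign_pos (by positivity), one_mul, sign_cast_real]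
  · right; exact sign_cast_real _
  · left; rfl

theorem matchingMatrix_ne_zero {P : SignPattern n} {I : Finset (Fin n)} {m : Fin n → Fin n}
    {i j : Fin n} (h : matchingMatrix P I m i j ≠ 0) : (i ∈ I ∧ j = m i) ∨ (j ∈ I ∧ i = m j) := by
  unfold matchingMatrix at h
  split_ifs at h with h1 h2
  · exact Or.inl h1
  · exact Or.inr h2
  · exact absurd rfl h

section Matching

variable {P : SignPattern n} {I : Finset (Fin n)} {m : Fin n → Fin n}

theorem matchingMatrix_apply_left (hM : IsMatchingMap P.graph I m) {x : Fin n} (hx : x ∈ I)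
    {i : Fin n} (hi : i ≠ m x) : matchingMatrix P I m i x = 0 := by
  by_contra h
  rcases matchingMatrix_ne_zero h with ⟨h1, rfl⟩ | h1
  · exact hM.notMem i h1 hx
  · exact hi h1.2

theorem matchingMatrix_apply_right (hM : IsMatchingMap P.graph I m) {x : Fin n} (hx : x ∈ I)
    {i : Fin n} (hi : i ≠ x) : matchingMatrix P I m i (m x) = 0 := by
  by_contra h
  rcases matchingMatrix_ne_zero h with h1 | h1
  · exact hi (hM.injOn h1.1 hx h1.2.symm)
  · exact hM.notMem x hx h1.1

theorem matchingMatrix_edge (hM : IsMatchingMap P.graph I m) {x : Fin n} (hx : x ∈ I) :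
    matchingMatrix P I m x (m x) ≠ 0 ∧
    matchingMatrix P I m x (m x) * matchingMatrix P I m (m x) x =
      ((x : ℝ) + 2) * (P.edgeSign s(x, m x) : ℝ) := by
  have h1 : matchingMatrix P I m x (m x) = ((x : ℝ) + 2) * (P x (m x) : ℝ) := by
    simp [matchingMatrix, hx]
  have h2 : matchingMatrix P I m (m x) x = (P (m x) x : ℝ) := by
    simp [matchingMatrix, hx, hM.notMem x hx]
  have h3 := (hM.adj x hx).2
  rw [h1, h2]
  refine ⟨mul_ne_zero (by positivity) ?_, ?_⟩
  · rw [← sign_ne_zero, sign_cast_real]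
    exact left_ne_zero_of_mul h3
  · rw [edgeSign_mk, SignType.coe_mul]
    ring

/-- The numbers `± √(x + 2)` for `x ∈ J`. -/
noncomputable def signedSqrts (J : Finset (Fin n)) : Finset ℝ :=
  J.image (fun x : Fin n => √((x : ℝ) + 2)) ∪ J.image (fun x : Fin n => -√((x : ℝ) + 2))

theorem mem_signedSqrts {J : Finset (Fin n)} {r : ℝ} (h : r ∈ signedSqrts J) :
    ∃ x ∈ J, r ^ 2 = (x : ℝ) + 2 := by
  rcases Finset.mem_union.1 h with h | h <;> obtain ⟨x, hx, rfl⟩ := Finset.mem_image.1 h <;>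
    refine ⟨x, hx, ?_⟩ <;> simp [Real.sq_sqrt (show (0 : ℝ) ≤ (x : ℝ) + 2 by positivity)]

theorem ne_zero_of_mem_signedSqrts {J : Finset (Fin n)} {r : ℝ} (h : r ∈ signedSqrts J) :
    r ≠ 0 := by
  obtain ⟨x, -, hx⟩ := mem_signedSqrts h
  rintro rfl
  have : (0 : ℝ) ≤ x := by positivity
  nlinarith

/-- The distinct weights `x + 2` of the matching edges serve to make these eigenvalues distinct. -/
theorem card_signedSqrts (J : Finset (Fin n)) : (signedSqrts J).card = 2 * J.card := by
  have hinj : Function.Injective (fun x : Fin n => √((x : ℝ) + 2)) := by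
    intro x y h
    have h' := (Real.sqrt_inj (by positivity) (by positivity)).1 h
    exact Fin.ext (by exact_mod_cast add_right_cancel h')
  rw [signedSqrts, Finset.card_union_of_disjoint, Finset.card_image_of_injective _ hinj,
    Finset.card_image_of_injective, two_mul]
  · intro x y h
    exact hinj (neg_injective h)
  · rw [Finset.disjoint_left]
    intro r h1 h2
    obtain ⟨x, -, rfl⟩ := Finset.mem_image.1 h1
    obtain ⟨y, -, hy⟩ := Finset.mem_image.1 h2
    have h3 : 0 < √((x : ℝ) + 2) := by positivity
    have h4 : 0 < √((y : ℝ) + 2) := by positivity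
    linarith

theorem isRoot_of_matching (hM : IsMatchingMap P.graph I m) (B : Matrix (Fin n) (Fin n) ℝ)
    {x : Fin n} (hx : x ∈ I) (hBx : ∀ i, B i x = matchingMatrix P I m i x)
    (hBy : ∀ i, B i (m x) = matchingMatrix P I m i (m x)) (μ : ℂ)
    (hμ : μ ^ 2 = ((((x : ℝ) + 2) * (P.edgeSign s(x, m x) : ℝ) : ℝ) : ℂ)) :
    (B.map Complex.ofRealHom).charpoly.IsRoot μ := by
  obtain ⟨h1, h2⟩ := matchingMatrix_edge hM hx
  refine isRoot_charpoly_of_isolated_pair _ (hM.adj x hx).ne (fun i hi => ?_) (fun i hi => ?_)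
    ?_ μ ?_
  · simp [hBx, matchingMatrix_apply_left hM hx hi]
  · simp [hBy, matchingMatrix_apply_right hM hx hi]
  · simpa [hBy] using h1
  · rw [hμ, ← h2]
    simp [hBy, hBx]

theorem isRoot_of_matching_pos (hM : IsMatchingMap P.graph I m)
    (B : Matrix (Fin n) (Fin n) ℝ) {J : Finset (Fin n)} (hJ : J ⊆ I)
    (hsign : ∀ x ∈ J, P.edgeSign s(x, m x) = 1)
    (hBx : ∀ x ∈ J, ∀ i, B i x = matchingMatrix P I m i x)
    (hBy : ∀ x ∈ J, ∀ i, B i (m x) = matchingMatrix P I m i (m x)) {r : ℝ}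
    (hr : r ∈ signedSqrts J) : (B.map Complex.ofRealHom).charpoly.IsRoot (r : ℂ) := by
  obtain ⟨x, hx, hr⟩ := mem_signedSqrts hr
  refine isRoot_of_matching hM B (hJ hx) (hBx x hx) (hBy x hx) _ ?_
  rw [hsign x hx, ← Complex.ofReal_pow, hr]
  simp

theorem isRoot_of_matching_neg (hM : IsMatchingMap P.graph I m)
    (B : Matrix (Fin n) (Fin n) ℝ) {J : Finset (Fin n)} (hJ : J ⊆ I)
    (hsign : ∀ x ∈ J, P.edgeSign s(x, m x) = -1)
    (hBx : ∀ x ∈ J, ∀ i, B i x = matchingMatrix P I m i x)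
    (hBy : ∀ x ∈ J, ∀ i, B i (m x) = matchingMatrix P I m i (m x)) {r : ℝ}
    (hr : r ∈ signedSqrts J) :
    (B.map Complex.ofRealHom).charpoly.IsRoot (Complex.I * (r : ℂ)) := by
  obtain ⟨x, hx, hr⟩ := mem_signedSqrts hr
  refine isRoot_of_matching hM B (hJ hx) (hBx x hx) (hBy x hx) _ ?_
  rw [hsign x hx, mul_pow, Complex.I_sq, ← Complex.ofReal_pow, hr]
  simp

theorem ofReal_injective_mul {ζ : ℂ} (hζ : ζ ≠ 0) :
    Function.Injective (fun r : ℝ => ζ * (r : ℂ)) := fun _ _ h =>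
  Complex.ofReal_injective (mul_left_cancel₀ hζ h)

/-- If every matrix of the class has `0` as an eigenvalue of multiplicity at least `n - Z`, then
some matrix of the class has at least `n - Z + 2 p` real eigenvalues, where `p` is the number of
positive edges of a matching. -/
theorem exists_le_numRealEigenvalues (hM : IsMatchingMap P.graph I m) (Z : ℕ)
    (hZ : ∀ A ∈ P.qualitativeClass, n ≤ A.charpoly.rootMultiplicity 0 + Z) :
    ∃ A ∈ P.qualitativeClass,
      n + 2 * (I.filter fun x => P.edgeSign s(x, m x) = 1).card ≤ numRealEigenvalues A + Z := by
  classical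
  set B := matchingMatrix P I m with hB
  set Ip := I.filter fun x => P.edgeSign s(x, m x) = 1 with hIp
  set In := I.filter fun x => ¬ P.edgeSign s(x, m x) = 1 with hIn
  have hIn' : ∀ x ∈ In, P.edgeSign s(x, m x) = -1 := fun x hx =>
    (edgeSign_eq_of_adj P (hM.adj x (Finset.mem_filter.1 hx).1)).resolve_left
      (Finset.mem_filter.1 hx).2
  have hcard : Ip.card + In.card = I.card := Finset.card_filter_add_card_filter_not _
  -- The imaginary eigenvalues are included so that `S` and the root `0` exhaust the degree, which
  -- makes the real ones simple.
  set S : Finset ℂ := (signedSqrts Ip).image (fun r : ℝ => (1 : ℂ) * (r : ℂ)) ∪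
    (signedSqrts In).image (fun r : ℝ => Complex.I * (r : ℂ)) with hS
  have hScard : S.card = 2 * I.card := by
    rw [hS, Finset.card_union_of_disjoint, Finset.card_image_of_injective _
      (ofReal_injective_mul one_ne_zero), Finset.card_image_of_injective _
      (ofReal_injective_mul Complex.I_ne_zero), card_signedSqrts, card_signedSqrts]
    · omega
    · rw [Finset.disjoint_left]
      intro w h1 h2
      obtain ⟨r, hr, rfl⟩ := Finset.mem_image.1 h1
      obtain ⟨r', -, h3⟩ := Finset.mem_image.1 h2
      have := congrArg Complex.re h3
      simp at this
      exact ne_zero_of_mem_signedSqrts hr this.symm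
  have hSroot : ∀ w ∈ S, w ≠ 0 ∧ (B.map Complex.ofRealHom).charpoly.IsRoot w := by
    intro w hw
    rcases Finset.mem_union.1 hw with hw | hw <;> obtain ⟨r, hr, rfl⟩ := Finset.mem_image.1 hw
    · refine ⟨by simpa using ne_zero_of_mem_signedSqrts hr, ?_⟩
      simp only [one_mul]
      exact isRoot_of_matching_pos hM B (Finset.filter_subset _ _)
        (fun x hx => (Finset.mem_filter.1 hx).2) (fun _ _ _ => rfl) (fun _ _ _ => rfl) hr
    · exact ⟨by simpa using ne_zero_of_mem_signedSqrts hr,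
        isRoot_of_matching_neg hM B (Finset.filter_subset _ _) hIn' (fun _ _ _ => rfl)
          (fun _ _ _ => rfl) hr⟩
  have hmult := card_le_rootMultiplicity_zero_add (B.map Complex.ofRealHom) I I (by
    intro i j h
    rcases matchingMatrix_ne_zero (P := P) (I := I) (m := m) (i := i) (j := j)
      (by intro h0; apply h; simp [hB, h0]) with h | h
    · exact Or.inl h.1
    · exact Or.inr h.1)
  have hsimple : ∀ r ∈ signedSqrts Ip, r ≠ 0 ∧ B.charpoly.rootMultiplicity r = 1 := by
    intro r hr
    refine ⟨ne_zero_of_mem_signedSqrts hr, ?_⟩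
    rw [Polynomial.eq_rootMultiplicity_map Complex.ofRealHom.injective, ← Matrix.charpoly_map]
    refine rootMultiplicity_eq_one_of_card_le _ (Matrix.charpoly_monic _).ne_zero S hSroot ?_ _ ?_
    · rw [Matrix.charpoly_natDegree_eq_dim]
      omega
    · exact Finset.mem_union_left _ (Finset.mem_image.2 ⟨r, hr, by simp⟩)
  have hev := eventually_exists_roots B (P.map (fun s : SignType => (s : ℝ))) _ hsimple
  obtain ⟨t, ⟨S', hS'c, hS'⟩, ht⟩ :=
    ((hev.filter_mono nhdsWithin_le_nhds).and (self_mem_nhdsWithin (s := Set.Ioi 0))).exists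
  refine ⟨_, (matchingMatrix_subordinate P I m).add_smul_mem ht, ?_⟩
  -- The multiplicity of `0` may drop under perturbation, so the bound must hold for the perturbed
  -- matrix itself.
  have h1 := hZ _ ((matchingMatrix_subordinate P I m).add_smul_mem ht)
  have h2 := rootMultiplicity_zero_add_card_le _ (Matrix.charpoly_monic _).ne_zero S' hS'
  rw [card_signedSqrts] at hS'c
  unfold numRealEigenvalues
  rw [← hB] at h1 ⊢
  omega

theorem exists_numRealEigenvalues_add_card_le {B : Matrix (Fin n) (Fin n) ℝ}
    (hB : P.IsSubordinate B) (S : Finset ℂ)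
    (hS : ∀ w ∈ S, w.im ≠ 0 ∧ (B.map Complex.ofRealHom).charpoly.IsRoot w) :
    ∃ A ∈ P.qualitativeClass, numRealEigenvalues A + S.card ≤ n := by
  have hev := eventually_card_roots_add_le B (P.map (fun s : SignType => (s : ℝ))) S hS
  obtain ⟨t, h, ht⟩ :=
    ((hev.filter_mono nhdsWithin_le_nhds).and (self_mem_nhdsWithin (s := Set.Ioi 0))).exists
  exact ⟨_, hB.add_smul_mem ht, by simpa [numRealEigenvalues] using h⟩

theorem im_ne_zero_of_mem_signedSqrts {J : Finset (Fin n)} {r : ℝ} (h : r ∈ signedSqrts J) :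
    (Complex.I * (r : ℂ)).im ≠ 0 := by
  simpa using ne_zero_of_mem_signedSqrts h

/-- Some matrix of the class has at most `n - 2 q` real eigenvalues, where `q` is the number of
negative edges of a matching. -/
theorem exists_numRealEigenvalues_le (hM : IsMatchingMap P.graph I m) :
    ∃ A ∈ P.qualitativeClass,
      numRealEigenvalues A + 2 * (I.filter fun x => P.edgeSign s(x, m x) = -1).card ≤ n := by
  classical
  obtain ⟨A, hA, h⟩ := exists_numRealEigenvalues_add_card_le (matchingMatrix_subordinate P I m)
    ((signedSqrts (I.filter fun x => P.edgeSign s(x, m x) = -1)).image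
      (fun r : ℝ => Complex.I * (r : ℂ))) (by
      intro w hw
      obtain ⟨r, hr, rfl⟩ := Finset.mem_image.1 hw
      exact ⟨im_ne_zero_of_mem_signedSqrts hr, isRoot_of_matching_neg hM _
        (Finset.filter_subset _ _) (fun x hx => (Finset.mem_filter.1 hx).2) (fun _ _ _ => rfl)
        (fun _ _ _ => rfl) hr⟩)
  refine ⟨A, hA, ?_⟩
  rwa [Finset.card_image_of_injective _ (ofReal_injective_mul Complex.I_ne_zero),
    card_signedSqrts] at h

end Matching

/-! ### Cyclic enumerations and eigenvalues of a directed cycle. -/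

/-- `u` runs periodically through the `k` distinct vertices of a cycle of `G`. -/
structure IsCyclicEnum {V : Type*} (G : SimpleGraph V) (k : ℕ) (u : ℕ → V) : Prop where
  three_le : 3 ≤ k
  adj : ∀ j, G.Adj (u j) (u (j + 1))
  eq_iff : ∀ i j, u i = u j ↔ i ≡ j [MOD k]

namespace IsCyclicEnum

variable {V : Type*} {G : SimpleGraph V} {k : ℕ} {u : ℕ → V}

theorem add_period (hu : IsCyclicEnum G k u) (j : ℕ) : u (j + k) = u j :=
  (hu.eq_iff _ _).2 (by simp [Nat.ModEq])

theorem succ_eq (hu : IsCyclicEnum G k u) {i j : ℕ} (h : u i = u j) : u (i + 1) = u (j + 1) :=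
  (hu.eq_iff _ _).2 (((hu.eq_iff _ _).1 h).add_right 1)

theorem shift (hu : IsCyclicEnum G k u) (a : ℕ) : IsCyclicEnum G k (fun j => u (j + a)) where
  three_le := hu.three_le
  adj j := by simpa [add_right_comm] using hu.adj (j + a)
  eq_iff i j := (hu.eq_iff _ _).trans ⟨fun h => h.add_right_cancel', fun h => h.add_right a⟩

theorem exists_lt (hu : IsCyclicEnum G k u) (j : ℕ) : ∃ i < k, u i = u j :=
  ⟨j % k, Nat.mod_lt _ (by have := hu.three_le; omega),
    (hu.eq_iff _ _).2 (Nat.mod_modEq j k)⟩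

theorem injOn (hu : IsCyclicEnum G k u) {i j : ℕ} (hi : i < k) (hj : j < k) (h : u i = u j) :
    i = j := ((hu.eq_iff _ _).1 h).eq_of_lt_of_lt hi hj

end IsCyclicEnum

/-- The polynomial `X ^ k - f` is separable, and its real roots can only be `1` and `-1`; for odd
`k` only `f` itself. -/
theorem exists_nonreal_roots_of_unit {k : ℕ} (hk : 0 < k) {f : ℝ} (hf : f = 1 ∨ f = -1) :
    ∃ R : Finset ℂ, (∀ w ∈ R, w.im ≠ 0 ∧ w ^ k = (f : ℂ)) ∧ k ≤ R.card + 2 ∧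
      (Odd k → k ≤ R.card + 1) := by
  have hf0 : (f : ℂ) ≠ 0 := by rcases hf with rfl | rfl <;> simp
  have hsep : (X ^ k - C (f : ℂ)).Separable :=
    separable_X_pow_sub_C _ (by exact_mod_cast hk.ne') hf0
  have hcard : (nthRoots k (f : ℂ)).toFinset.card = k := by
    rw [nthRoots, Multiset.toFinset_card_of_nodup (nodup_roots hsep),
      ← (IsAlgClosed.splits _).natDegree_eq_card_roots, natDegree_X_pow_sub_C]
  have hsum := Finset.card_filter_add_card_filter_not (s := (nthRoots k (f : ℂ)).toFinset)
    (fun w : ℂ => w.im ≠ 0)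
  rw [hcard] at hsum
  have hreal : ∀ w ∈ (nthRoots k (f : ℂ)).toFinset.filter (fun w => ¬ w.im ≠ 0),
      ∃ r : ℝ, w = r ∧ r ^ k = f ∧ (r = 1 ∨ r = -1) := by
    intro w hw
    simp only [Finset.mem_filter, Multiset.mem_toFinset, mem_nthRoots hk, not_not] at hw
    obtain ⟨h1, h2⟩ := hw
    have h3 : w = (w.re : ℂ) := Complex.ext (by simp) (by simp [h2])
    have h4 : w.re ^ k = f := by
      rw [h3] at h1
      exact_mod_cast h1
    refine ⟨w.re, h3, h4, ?_⟩
    have h5 : |w.re| ^ k = 1 := by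
      rw [← abs_pow, h4]
      rcases hf with rfl | rfl <;> simp
    have h6 := (pow_eq_one_iff_of_nonneg (abs_nonneg _) hk.ne').1 h5
    exact eq_or_eq_neg_of_abs_eq h6
  refine ⟨(nthRoots k (f : ℂ)).toFinset.filter fun w => w.im ≠ 0, fun w hw => ?_, ?_, ?_⟩
  · rw [Finset.mem_filter, Multiset.mem_toFinset, mem_nthRoots hk] at hw
    exact ⟨hw.2, hw.1⟩
  · have : ((nthRoots k (f : ℂ)).toFinset.filter fun w => ¬ w.im ≠ 0) ⊆ {1, -1} := by
      intro w hw
      obtain ⟨r, rfl, -, rfl | rfl⟩ := hreal w hw <;> simp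
    have := (Finset.card_le_card this).trans Finset.card_le_two
    omega
  · intro hodd
    have : ((nthRoots k (f : ℂ)).toFinset.filter fun w => ¬ w.im ≠ 0) ⊆ {(f : ℂ)} := by
      intro w hw
      obtain ⟨r, rfl, h, hr⟩ := hreal w hw
      have : r ^ k = r := by
        rcases hr with rfl | rfl
        · simp
        · exact hodd.neg_one_pow
      simp [← h, this]
    have := Finset.card_le_card this
    rw [Finset.card_singleton] at this
    omega

section DirectedCycle

variable {P : SignPattern n} {I : Finset (Fin n)} {m : Fin n → Fin n} {k : ℕ} {u : ℕ → Fin n}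

open Classical in
/-- The matrix supported on a directed cycle and on the edges of a matching. -/
noncomputable def cycleMatrix (P : SignPattern n) (I : Finset (Fin n)) (m : Fin n → Fin n)
    (u : ℕ → Fin n) : Matrix (Fin n) (Fin n) ℝ := fun i j =>
  if ∃ l, i = u l ∧ j = u (l + 1) then (P i j : ℝ) else matchingMatrix P I m i j

theorem cycleMatrix_subordinate (P : SignPattern n) (I : Finset (Fin n)) (m : Fin n → Fin n)
    (u : ℕ → Fin n) : P.IsSubordinate (cycleMatrix P I m u) := by
  intro i j
  unfold cycleMatrix
  split_ifs
  · right; exact sign_cast_real _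
  · exact matchingMatrix_subordinate P I m i j

theorem cycleMatrix_apply_of_notMem (P : SignPattern n) (I : Finset (Fin n))
    (m : Fin n → Fin n) {u : ℕ → Fin n} {x : Fin n} (hx : ∀ l, u l ≠ x) (i : Fin n) :
    cycleMatrix P I m u i x = matchingMatrix P I m i x := by
  unfold cycleMatrix
  rw [if_neg]
  rintro ⟨l, -, h⟩
  exact hx _ h.symm

theorem sign_mul_self_of_adj {x y : Fin n} (h : P.graph.Adj x y) :
    (P x y : ℝ) * (P x y : ℝ) = 1 := by
  have h0 : P x y ≠ 0 := left_ne_zero_of_mul h.2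
  rcases SignType.trichotomy (P x y) with h1 | h1 | h1
  · simp [h1]
  · exact absurd h1 h0
  · simp [h1]

theorem isRoot_cycleMatrix (hu : IsCyclicEnum P.graph k u) (hI : ∀ x ∈ I, ∀ l, u l ≠ x)
    (hmI : ∀ x ∈ I, ∀ l, u l ≠ m x) (μ : ℂ)
    (hμ : μ ^ k = ((∏ l ∈ Finset.range k, (P (u l) (u (l + 1)) : ℝ) : ℝ) : ℂ)) :
    ((cycleMatrix P I m u).map Complex.ofRealHom).charpoly.IsRoot μ := by
  classical
  set s : ℕ → ℂ := fun l => ((P (u l) (u (l + 1)) : ℝ) : ℂ) with hs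
  have hss : ∀ l, s l * s l = 1 := fun l => by
    simp only [hs]
    exact_mod_cast congrArg Complex.ofReal (sign_mul_self_of_adj (hu.adj l))
  have hsper : ∀ l, s (k + l) = s l := fun l => by
    have h1 : u (k + l) = u l := by rw [add_comm]; exact hu.add_period l
    simp only [hs, h1, hu.succ_eq h1]
  have hμ' : μ ^ k = ∏ l ∈ Finset.range k, s l := by rw [hμ]; simp [hs]
  -- Solving the eigenvector equation along the cycle gives `w`, since each sign is its own inverse.
  -- The condition on `μ ^ k` makes it close up after `k` steps.
  set w : ℕ → ℂ := fun j => μ ^ j * ∏ l ∈ Finset.range j, s l with hw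
  have hwsucc : ∀ j, s j * w (j + 1) = μ * w j := fun j => by
    simp only [hw, Finset.prod_range_succ]
    linear_combination (μ ^ (j + 1) * ∏ l ∈ Finset.range j, s l) * hss j
  have hprod : (∏ l ∈ Finset.range k, s l) * (∏ l ∈ Finset.range k, s l) = 1 := by
    rw [← Finset.prod_mul_distrib]
    exact Finset.prod_eq_one fun l _ => hss l
  have hwper : Function.Periodic w k := fun j => by
    simp only [hw]
    rw [add_comm j k, Finset.prod_range_add, pow_add, hμ']
    simp only [hsper]
    linear_combination (μ ^ j * ∏ l ∈ Finset.range j, s l) * hprod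
  set v : Fin n → ℂ := fun i => if h : ∃ j, u j = i then w h.choose else 0 with hv
  have hvu : ∀ j, v (u j) = w j := fun j => by
    have hex : ∃ j', u j' = u j := ⟨j, rfl⟩
    simp only [hv]
    rw [dif_pos hex, ← hwper.map_mod_nat, ← hwper.map_mod_nat j]
    exact congrArg w ((hu.eq_iff _ _).1 hex.choose_spec)
  have hv0 : ∀ i, (∀ j, u j ≠ i) → v i = 0 := fun i hi => by
    simp only [hv]
    rw [dif_neg]
    rintro ⟨j, hj⟩
    exact hi j hj
  refine isRoot_charpoly_of_mulVec_eq _ v ?_ μ ?_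
  · intro h
    have h1 := congrFun h (u 0)
    rw [hvu] at h1
    simp [hw] at h1
  · funext i
    rw [Matrix.mulVec, dotProduct]
    by_cases hi : ∃ j, u j = i
    · obtain ⟨j, rfl⟩ := hi
      rw [Finset.sum_eq_single (u (j + 1))]
      · have : cycleMatrix P I m u (u j) (u (j + 1)) = (P (u j) (u (j + 1)) : ℝ) := by
          unfold cycleMatrix
          rw [if_pos ⟨j, rfl, rfl⟩]
        rw [Matrix.map_apply, this, hvu, Pi.smul_apply, hvu, smul_eq_mul]
        exact hwsucc j
      · intro b _ hb
        have : cycleMatrix P I m u (u j) b = 0 := by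
          unfold cycleMatrix
          rw [if_neg]
          · by_contra h0
            rcases matchingMatrix_ne_zero h0 with h | h
            · exact hI _ h.1 j rfl
            · exact hmI _ h.1 j h.2
          · rintro ⟨l, h1, h2⟩
            exact hb (h2.trans (hu.succ_eq h1).symm)
        simp [this]
      · simp
    · push Not at hi
      rw [Pi.smul_apply, hv0 i hi, smul_zero]
      refine Finset.sum_eq_zero fun b _ => ?_
      by_cases hb : ∃ j, u j = b
      · obtain ⟨j, rfl⟩ := hb
        have : cycleMatrix P I m u i (u j) = 0 := by
          unfold cycleMatrix
          rw [if_neg]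
          · by_contra h0
            rcases matchingMatrix_ne_zero h0 with h | h
            · exact hmI _ h.1 j h.2
            · exact hI _ h.1 j rfl
          · rintro ⟨l, h1, -⟩
            exact hi l h1.symm
        simp [this]
      · push Not at hb
        rw [hv0 b hb, mul_zero]

/-- A directed cycle together with a disjoint matching with `q` negative edges gives a matrix of
the class with at least `k - 2` (for odd `k`: `k - 1`) plus `2 q` nonreal eigenvalues. -/
theorem exists_numRealEigenvalues_cycle_le (hM : IsMatchingMap P.graph I m)
    (hu : IsCyclicEnum P.graph k u) (hI : ∀ x ∈ I, ∀ l, u l ≠ x)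
    (hmI : ∀ x ∈ I, ∀ l, u l ≠ m x) :
    ∃ A ∈ P.qualitativeClass,
      numRealEigenvalues A + 2 * (I.filter fun x => P.edgeSign s(x, m x) = -1).card + k ≤ n + 2 ∧
      (Odd k → numRealEigenvalues A +
        2 * (I.filter fun x => P.edgeSign s(x, m x) = -1).card + k ≤ n + 1) := by
  classical
  have hk : 0 < k := by have := hu.three_le; omega
  set f : ℝ := ∏ l ∈ Finset.range k, (P (u l) (u (l + 1)) : ℝ) with hf
  have hf1 : f = 1 ∨ f = -1 := by
    rw [← mul_self_eq_one_iff, hf, ← Finset.prod_mul_distrib]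
    exact Finset.prod_eq_one fun l _ => sign_mul_self_of_adj (hu.adj l)
  set J := I.filter fun x => P.edgeSign s(x, m x) = -1 with hJ
  have hJI : J ⊆ I := Finset.filter_subset _ _
  set T := (signedSqrts J).image (fun r : ℝ => Complex.I * (r : ℂ)) with hT
  obtain ⟨R, hR, h1, h2⟩ := exists_nonreal_roots_of_unit hk hf1
  -- Points of `T` have squared modulus `x + 2 > 1`, while those of `R` lie on the unit circle.
  have hdisj : Disjoint T R := by
    rw [Finset.disjoint_left]
    intro w hwT hwR
    obtain ⟨r, hr, rfl⟩ := Finset.mem_image.1 hwT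
    obtain ⟨x, -, hx⟩ := mem_signedSqrts hr
    have h4 := congrArg norm (hR _ hwR).2
    rw [norm_pow, norm_mul, Complex.norm_I, one_mul, Complex.norm_real, Complex.norm_real] at h4
    have h5 : ‖f‖ = 1 := by rcases hf1 with h | h <;> simp [h]
    rw [h5] at h4
    have h6 := (pow_eq_one_iff_of_nonneg (norm_nonneg _) hk.ne').1 h4
    rw [← sq_abs, ← Real.norm_eq_abs, h6] at hx
    have : (0 : ℝ) ≤ x := by positivity
    linarith
  obtain ⟨A, hA, h⟩ := exists_numRealEigenvalues_add_card_le (cycleMatrix_subordinate P I m u)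
    (T ∪ R) (by
      intro w hw
      rcases Finset.mem_union.1 hw with hw | hw
      · obtain ⟨r, hr, rfl⟩ := Finset.mem_image.1 hw
        refine ⟨im_ne_zero_of_mem_signedSqrts hr, isRoot_of_matching_neg hM _ hJI
          (fun x hx => (Finset.mem_filter.1 hx).2) (fun x hx => ?_) (fun x hx => ?_) hr⟩
        · exact cycleMatrix_apply_of_notMem P I m (hI x (hJI hx))
        · exact cycleMatrix_apply_of_notMem P I m (hmI x (hJI hx))
      · exact ⟨(hR w hw).1, isRoot_cycleMatrix hu hI hmI w (hR w hw).2⟩)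
  rw [Finset.card_union_of_disjoint hdisj, hT,
    Finset.card_image_of_injective _ (ofReal_injective_mul Complex.I_ne_zero),
    card_signedSqrts] at h
  refine ⟨A, hA, by omega, fun hodd => ?_⟩
  have := h2 hodd
  omega

end DirectedCycle

/-! ### Comparing matrices built from a cycle and a disjoint matching. -/

/-- A cycle, enumerated by `u`, together with a matching of the vertices of `O` with other vertices
off the cycle, such that every edge that does not meet `O` joins two vertices of the cycle. -/
structure IsCycleMatching {V : Type*} (G : SimpleGraph V) (k : ℕ) (u : ℕ → V) (O : Finset V)
    (m : V → V) : Prop where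
  enum : IsCyclicEnum G k u
  matching : IsMatchingMap G O m
  ne_of_mem : ∀ x ∈ O, ∀ l, u l ≠ x
  ne_map_of_mem : ∀ x ∈ O, ∀ l, u l ≠ m x
  cover : ∀ x y, G.Adj x y → x ∈ O ∨ y ∈ O ∨ ∃ l, u l = x

theorem IsCycleMatching.shift {V : Type*} {G : SimpleGraph V} {k : ℕ} {u : ℕ → V} {O : Finset V}
    {m : V → V} (h : IsCycleMatching G k u O m) (a : ℕ) :
    IsCycleMatching G k (fun j => u (j + a)) O m where
  enum := h.enum.shift a
  matching := h.matching
  ne_of_mem x hx l := h.ne_of_mem x hx _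
  ne_map_of_mem x hx l := h.ne_map_of_mem x hx _
  cover x y hxy := by
    rcases h.cover x y hxy with h1 | h1 | ⟨l, rfl⟩
    · exact Or.inl h1
    · exact Or.inr (Or.inl h1)
    · refine Or.inr (Or.inr ⟨l + a * k - a, (h.enum.eq_iff _ _).2 ?_⟩)
      have : a ≤ l + a * k := by nlinarith [h.enum.three_le]
      rw [Nat.sub_add_cancel this]
      simp [Nat.ModEq]

open Classical in
/-- The map that extends `m` from `O` by `u j ↦ u (j + 1)`. -/
noncomputable def extendMap {V : Type*} (u : ℕ → V) (O : Finset V) (m : V → V) (x : V) : V :=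
  if x ∈ O then m x else if h : ∃ j, u j = x then u (h.choose + 1) else x

namespace IsCycleMatching

variable {P : SignPattern n} {k : ℕ} {u : ℕ → Fin n} {O : Finset (Fin n)} {m : Fin n → Fin n}

theorem extendMap_of_mem {V : Type*} (u : ℕ → V) {O : Finset V} (m : V → V) {x : V}
    (hx : x ∈ O) : extendMap u O m x = m x := if_pos hx

theorem extendMap_enum (h : IsCycleMatching P.graph k u O m) (j : ℕ) :
    extendMap u O m (u j) = u (j + 1) := by
  have h1 : u j ∉ O := fun hj => h.ne_of_mem _ hj j rfl
  have h2 : ∃ i, u i = u j := ⟨j, rfl⟩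
  rw [extendMap, if_neg h1, dif_pos h2]
  exact h.enum.succ_eq h2.choose_spec

/-- The condition `hsep` makes the cycle edges chosen by `J` pairwise disjoint. -/
theorem isMatchingMap_union (h : IsCycleMatching P.graph k u O m) (J : Finset ℕ)
    (hsep : ∀ i ∈ J, ∀ j ∈ J, u (i + 1) ≠ u j) :
    IsMatchingMap P.graph (O ∪ J.image u) (extendMap u O m) where
  adj x hx := by
    rcases Finset.mem_union.1 hx with hx | hx
    · rw [extendMap_of_mem u m hx]; exact h.matching.adj x hx
    · obtain ⟨j, -, rfl⟩ := Finset.mem_image.1 hx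
      rw [h.extendMap_enum]; exact h.enum.adj j
  injOn x hx y hy hxy := by
    rcases Finset.mem_union.1 hx with hx | hx <;> rcases Finset.mem_union.1 hy with hy | hy
    · rw [extendMap_of_mem u m hx, extendMap_of_mem u m hy] at hxy
      exact h.matching.injOn hx hy hxy
    · obtain ⟨j, -, rfl⟩ := Finset.mem_image.1 hy
      rw [extendMap_of_mem u m hx, h.extendMap_enum] at hxy
      exact absurd hxy.symm (h.ne_map_of_mem x hx _)
    · obtain ⟨j, -, rfl⟩ := Finset.mem_image.1 hx
      rw [extendMap_of_mem u m hy, h.extendMap_enum] at hxy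
      exact absurd hxy (h.ne_map_of_mem y hy _)
    · obtain ⟨i, -, rfl⟩ := Finset.mem_image.1 hx
      obtain ⟨j, -, rfl⟩ := Finset.mem_image.1 hy
      rw [h.extendMap_enum, h.extendMap_enum, h.enum.eq_iff] at hxy
      exact (h.enum.eq_iff _ _).2 hxy.add_right_cancel'
  notMem x hx hmem := by
    rcases Finset.mem_union.1 hx with hx | hx
    · rw [extendMap_of_mem u m hx] at hmem
      rcases Finset.mem_union.1 hmem with hm | hm
      · exact h.matching.notMem x hx hm
      · obtain ⟨j, -, hj⟩ := Finset.mem_image.1 hm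
        exact h.ne_map_of_mem x hx j hj
    · obtain ⟨i, hi, rfl⟩ := Finset.mem_image.1 hx
      rw [h.extendMap_enum] at hmem
      rcases Finset.mem_union.1 hmem with hm | hm
      · exact h.ne_of_mem _ hm _ rfl
      · obtain ⟨j, hj, hj'⟩ := Finset.mem_image.1 hm
        exact hsep i hi j hj hj'.symm

theorem card_filter_union (h : IsCycleMatching P.graph k u O m) (J : Finset ℕ)
    (hJ : ∀ j ∈ J, j < k) (σ : SignType) (hσ : ∀ j ∈ J, P.edgeSign s(u j, u (j + 1)) = σ) :
    ((O ∪ J.image u).filter fun x => P.edgeSign s(x, extendMap u O m x) = σ).card =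
      (O.filter fun x => P.edgeSign s(x, m x) = σ).card + J.card := by
  have h1 : ((J.image u).filter fun x => P.edgeSign s(x, extendMap u O m x) = σ) = J.image u := by
    refine Finset.filter_true_of_mem fun x hx => ?_
    obtain ⟨j, hj, rfl⟩ := Finset.mem_image.1 hx
    rw [h.extendMap_enum]
    exact hσ j hj
  have h2 : (O.filter fun x => P.edgeSign s(x, extendMap u O m x) = σ) =
      O.filter fun x => P.edgeSign s(x, m x) = σ :=
    Finset.filter_congr fun x hx => by rw [extendMap_of_mem u m hx]
  rw [Finset.filter_union, h1, h2, Finset.card_union_of_disjoint, Finset.card_image_of_injOn]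
  · exact fun i hi j hj hij => h.enum.injOn (hJ i hi) (hJ j hj) hij
  · rw [Finset.disjoint_left]
    intro x hx hx'
    obtain ⟨j, -, rfl⟩ := Finset.mem_image.1 hx'
    exact h.ne_of_mem _ (Finset.mem_filter.1 hx).1 j rfl

theorem card_filter_add_card_filter (h : IsCycleMatching P.graph k u O m) :
    (O.filter fun x => P.edgeSign s(x, m x) = 1).card +
      (O.filter fun x => P.edgeSign s(x, m x) = -1).card = O.card := by
  rw [← Finset.card_filter_add_card_filter_not (s := O) fun x => P.edgeSign s(x, m x) = 1]
  congr 2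
  refine Finset.filter_congr fun x hx => ?_
  rcases edgeSign_eq_of_adj P (h.matching.adj x hx) with h | h <;> rw [h] <;> decide

theorem le_rootMultiplicity_zero_add (h : IsCycleMatching P.graph k u O m)
    (hsymm : P.IsCombSymmetric) (hdiag : P.IsZeroDiagonal) (A : Matrix (Fin n) (Fin n) ℝ)
    (hA : A ∈ P.qualitativeClass) :
    n ≤ A.charpoly.rootMultiplicity 0 + (2 * O.card + k) := by
  have h1 := card_le_rootMultiplicity_zero_add A (O ∪ (Finset.range k).image u) O (by
    intro i j hij
    have h0 : P i j ≠ 0 := by rw [← hA i j]; exact sign_ne_zero.2 hij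
    have hadj : P.graph.Adj i j := by
      refine ⟨?_, mul_ne_zero h0 ((hsymm i j).1 h0)⟩
      rintro rfl
      exact h0 (hdiag i)
    rcases h.cover i j hadj with h2 | h2 | ⟨l, rfl⟩
    · exact Or.inl (Finset.mem_union_left _ h2)
    · exact Or.inr h2
    · obtain ⟨l', hl', he⟩ := h.enum.exists_lt l
      exact Or.inl (Finset.mem_union_right _
        (Finset.mem_image.2 ⟨l', Finset.mem_range.2 hl', he⟩)))
  have h2 := Finset.card_union_le O ((Finset.range k).image u)
  have h3 := Finset.card_image_le (s := Finset.range k) (f := u)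
  rw [Finset.card_range] at h3
  rw [Fintype.card_fin] at h1
  omega

/-- In the bound `n - (2|O| + k) + 2(p + |J|)`, with `p` positive matching edges on `O`, the
relation `|O| = p + q` eliminates `p`. -/
theorem exists_many_real (h : IsCycleMatching P.graph k u O m)
    (hsymm : P.IsCombSymmetric) (hdiag : P.IsZeroDiagonal) (J : Finset ℕ)
    (hJ : ∀ j ∈ J, j < k) (hpos : ∀ j ∈ J, P.edgeSign s(u j, u (j + 1)) = 1)
    (hsep : ∀ i ∈ J, ∀ j ∈ J, u (i + 1) ≠ u j) :
    ∃ A ∈ P.qualitativeClass, n + 2 * J.card ≤ numRealEigenvalues A +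
      2 * (O.filter fun x => P.edgeSign s(x, m x) = -1).card + k := by
  obtain ⟨A, hA, hle⟩ := exists_le_numRealEigenvalues (h.isMatchingMap_union J hsep) _
    (h.le_rootMultiplicity_zero_add hsymm hdiag)
  refine ⟨A, hA, ?_⟩
  rw [h.card_filter_union J hJ 1 hpos] at hle
  have := h.card_filter_add_card_filter
  omega

theorem exists_few_real (h : IsCycleMatching P.graph k u O m) (J : Finset ℕ)
    (hJ : ∀ j ∈ J, j < k) (hneg : ∀ j ∈ J, P.edgeSign s(u j, u (j + 1)) = -1)
    (hsep : ∀ i ∈ J, ∀ j ∈ J, u (i + 1) ≠ u j) :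
    ∃ A ∈ P.qualitativeClass, numRealEigenvalues A +
      2 * (O.filter fun x => P.edgeSign s(x, m x) = -1).card + 2 * J.card ≤ n := by
  obtain ⟨A, hA, hle⟩ := exists_numRealEigenvalues_le (h.isMatchingMap_union J hsep)
  refine ⟨A, hA, ?_⟩
  rw [h.card_filter_union J hJ (-1) hneg] at hle
  omega

theorem not_isConsistent_of_ne {A A' : Matrix (Fin n) (Fin n) ℝ} (hA : A ∈ P.qualitativeClass)
    (hA' : A' ∈ P.qualitativeClass) (hne : numRealEigenvalues A ≠ numRealEigenvalues A') :
    ¬ P.IsConsistent := by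
  rintro ⟨k, -, hk⟩
  exact hne ((hk A hA).trans (hk A' hA').symm)

theorem adj_sep (h : IsCycleMatching P.graph k u O m) (j : ℕ) : u (j + 1) ≠ u j :=
  (h.enum.adj j).ne'

theorem not_isConsistent_of_two_pos (h : IsCycleMatching P.graph k u O m)
    (hsymm : P.IsCombSymmetric) (hdiag : P.IsZeroDiagonal) {a b : ℕ} (ha : a < k) (hb : b < k)
    (hpa : P.edgeSign s(u a, u (a + 1)) = 1) (hpb : P.edgeSign s(u b, u (b + 1)) = 1)
    (h1 : u a ≠ u b) (h2 : u (a + 1) ≠ u b) (h3 : u (b + 1) ≠ u a) : ¬ P.IsConsistent := by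
  obtain ⟨A, hA, hle⟩ := h.exists_many_real hsymm hdiag {a, b} (by simp [ha, hb])
    (by simp [hpa, hpb]) (by simp [h.adj_sep, h2, h3])
  obtain ⟨A', hA', hle', -⟩ := exists_numRealEigenvalues_cycle_le h.matching h.enum h.ne_of_mem
    h.ne_map_of_mem
  rw [Finset.card_pair (fun hab => h1 (congrArg u hab))] at hle
  exact not_isConsistent_of_ne hA hA' (by omega)

theorem not_isConsistent_of_odd (h : IsCycleMatching P.graph k u O m)
    (hsymm : P.IsCombSymmetric) (hdiag : P.IsZeroDiagonal) (hk : Odd k) {a : ℕ} (ha : a < k)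
    (hpa : P.edgeSign s(u a, u (a + 1)) = 1) : ¬ P.IsConsistent := by
  obtain ⟨A, hA, hle⟩ := h.exists_many_real hsymm hdiag {a} (by simp [ha])
    (by simp [hpa]) (by simp [h.adj_sep])
  obtain ⟨A', hA', -, hle'⟩ := exists_numRealEigenvalues_cycle_le h.matching h.enum h.ne_of_mem
    h.ne_map_of_mem
  have := hle' hk
  rw [Finset.card_singleton] at hle
  exact not_isConsistent_of_ne hA hA' (by omega)

theorem not_isConsistent_of_neg_class (h : IsCycleMatching P.graph k u O m)
    (hsymm : P.IsCombSymmetric) (hdiag : P.IsZeroDiagonal) (hk : Even k)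
    (hp : P.edgeSign s(u 0, u 1) = 1)
    (hneg : ∀ j < k, Odd j → P.edgeSign s(u j, u (j + 1)) = -1) : ¬ P.IsConsistent := by
  have hk3 := h.enum.three_le
  obtain ⟨A, hA, hle⟩ := h.exists_many_real hsymm hdiag {0} (by simp; omega)
    (by simp [hp]) (by simp only [Finset.mem_singleton, forall_eq]; exact h.adj_sep 0)
  -- The edges of odd index form a perfect matching of the even cycle, all negative.
  obtain ⟨A', hA', hle'⟩ := h.exists_few_real ((Finset.range (k / 2)).image fun i => 2 * i + 1)
    (by
      intro j hj
      obtain ⟨i, hi, rfl⟩ := Finset.mem_image.1 hj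
      have := Finset.mem_range.1 hi
      omega)
    (by
      intro j hj
      obtain ⟨i, hi, rfl⟩ := Finset.mem_image.1 hj
      have := Finset.mem_range.1 hi
      exact hneg _ (by omega) ⟨i, rfl⟩)
    (by
      intro i hi j hj hij
      obtain ⟨i, -, rfl⟩ := Finset.mem_image.1 hi
      obtain ⟨j, -, rfl⟩ := Finset.mem_image.1 hj
      -- As `k` is even, indices of equal vertices have equal parity.
      have h1 := ((h.enum.eq_iff _ _).1 hij).of_dvd (even_iff_two_dvd.1 hk)
      unfold Nat.ModEq at h1
      omega)
  rw [Finset.card_singleton] at hle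
  rw [Finset.card_image_of_injective _ (fun i j hij => by simpa using hij),
    Finset.card_range] at hle'
  have := even_iff_two_dvd.1 hk
  exact not_isConsistent_of_ne hA hA' (by omega)

end IsCycleMatching

/-! ### Distance to the cycle and the matching off it. -/

section Distance

variable {V : Type*} {G : SimpleGraph V} {v : V} {c : G.Walk v v}

theorem exists_mem_support_distTo_eq (c : G.Walk v v) (x : V) :
    ∃ y ∈ c.support, distTo c x = G.dist x y :=
  Nat.sInf_mem (s := {d | ∃ y ∈ c.support, d = G.dist x y}) ⟨_, v, c.start_mem_support, rfl⟩

theorem distTo_le (c : G.Walk v v) (x : V) {y : V} (hy : y ∈ c.support) :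
    distTo c x ≤ G.dist x y := Nat.sInf_le ⟨y, hy, rfl⟩

theorem distTo_eq_zero_iff (hG : G.Connected) (c : G.Walk v v) (x : V) :
    distTo c x = 0 ↔ x ∈ c.support := by
  constructor
  · intro h
    obtain ⟨y, hy, hxy⟩ := exists_mem_support_distTo_eq c x
    rw [h, eq_comm, hG.dist_eq_zero_iff] at hxy
    exact hxy ▸ hy
  · intro h
    have := distTo_le c x h
    rw [SimpleGraph.dist_self] at this
    omega

theorem distTo_le_add_one (hG : G.Connected) (c : G.Walk v v) {x y : V} (h : G.Adj x y) :
    distTo c x ≤ distTo c y + 1 := by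
  obtain ⟨z, hz, hyz⟩ := exists_mem_support_distTo_eq c y
  have h1 := distTo_le c x hz
  have h2 := hG.dist_triangle (u := x) (v := y) (w := z)
  rw [SimpleGraph.dist_eq_one_iff_adj.2 h] at h2
  omega

theorem exists_adj_distTo_add_one (hG : G.Connected) (c : G.Walk v v) {x : V}
    (hx : distTo c x ≠ 0) : ∃ y, G.Adj x y ∧ distTo c y + 1 = distTo c x := by
  obtain ⟨z, hz, hxz⟩ := exists_mem_support_distTo_eq c x
  obtain ⟨w, hw⟩ := hG.exists_walk_length_eq_dist x z
  cases w with
  | nil =>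
    simp only [SimpleGraph.Walk.length_nil] at hw
    omega
  | cons hadj p =>
    rename_i y
    refine ⟨y, hadj, ?_⟩
    have h1 := distTo_le c y hz
    have h2 := SimpleGraph.dist_le p
    have h3 := distTo_le_add_one hG c hadj
    rw [SimpleGraph.Walk.length_cons] at hw
    omega

/-- In a connected graph with only one cycle, a vertex off the cycle has at most one neighbour
which is not farther from the cycle. -/
theorem IsOnlyCycle.eq_of_distTo_le (hG : G.Connected) (hc : IsOnlyCycle c) {x y y' : V}
    (hx : distTo c x ≠ 0) (hy : G.Adj x y) (hy' : G.Adj x y') (hle : distTo c y ≤ distTo c x)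
    (hle' : distTo c y' ≤ distTo c x) : y = y' := by
  by_contra hne
  have hxc : x ∉ c.support := fun h => hx ((distTo_eq_zero_iff hG c x).2 h)
  have hnot : s(x, y) ∉ c.edges := fun h => hxc (c.fst_mem_support_of_mem_edges h)
  -- An edge that is not on the only cycle is a bridge; a second neighbour `y'` will yield a detour
  -- around it.
  have hbridge : G.IsBridge s(x, y) :=
    (SimpleGraph.isBridge_iff_forall_cycle_notMem hy).2
      fun w d hd h => hnot ((hc.2 w d hd _).1 h)
  rw [SimpleGraph.isBridge_iff] at hbridge
  set G' := G.deleteEdges {s(x, y)} with hG'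
  -- Descending towards the cycle from `z` never meets `x`, since the distance falls strictly below
  -- that of `x`. Hence the edge `{x, y}` is not used.
  have key : ∀ N, ∀ z, distTo c z = N → z ≠ x → N ≤ distTo c x → G'.Reachable z v := by
    intro N
    induction N with
    | zero =>
      intro z hz _ _
      classical
      have hzc := (distTo_eq_zero_iff hG c z).1 hz
      refine ⟨((c.takeUntil z hzc).transfer G' ?_).reverse⟩
      intro e he
      have hec := c.edges_takeUntil_subset_edges hzc he
      rw [hG', SimpleGraph.edgeSet_deleteEdges]
      exact ⟨c.edges_subset_edgeSet hec, fun h => hnot (h ▸ hec)⟩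
    | succ N ih =>
      intro z hz hzx hN
      obtain ⟨z', hadj, hz'⟩ := exists_adj_distTo_add_one hG c (x := z) (by omega)
      have hz'x : z' ≠ x := by rintro rfl; omega
      have h1 : G'.Adj z z' := by
        rw [hG', SimpleGraph.deleteEdges_adj]
        refine ⟨hadj, fun h => ?_⟩
        have : x ∈ s(z, z') := by
          rw [Set.mem_singleton_iff.1 h]; exact Sym2.mem_mk_left x y
        rcases Sym2.mem_iff.1 this with h | h
        · exact hzx h.symm
        · exact hz'x h.symm
      exact h1.reachable.trans (ih z' (by omega) hz'x (by omega))
  have h1 : G'.Adj x y' := by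
    rw [hG', SimpleGraph.deleteEdges_adj]
    refine ⟨hy', fun h => hne ?_⟩
    exact (Sym2.congr_right.1 (Set.mem_singleton_iff.1 h)).symm
  exact hbridge (h1.reachable.trans ((key _ y' rfl hy'.ne' hle').trans
    (key _ y rfl hy.ne' hle).symm))

/-- A neighbour `y` of `x` that is not farther from the cycle is the unique one and hence strictly
nearer, so the two distances differ by exactly one. -/
theorem IsOnlyCycle.odd_or_odd_of_adj (hG : G.Connected) (hc : IsOnlyCycle c) {x y : V}
    (hxy : G.Adj x y) (hx : distTo c x ≠ 0) : Odd (distTo c x) ∨ Odd (distTo c y) := by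
  have key : distTo c y = distTo c x + 1 ∨ distTo c y + 1 = distTo c x := by
    by_cases hle : distTo c y ≤ distTo c x
    · obtain ⟨z, hz, hzx⟩ := exists_adj_distTo_add_one hG c hx
      rw [hc.eq_of_distTo_le hG hx hxy hz hle (by omega)]
      exact Or.inr hzx
    · have := distTo_le_add_one hG c hxy.symm
      omega
  rw [Nat.odd_iff, Nat.odd_iff]
  omega

/-- A vertex at odd distance is not a leaf, and only one of its neighbours fails to be farther. -/
theorem IsOnlyCycle.exists_child (hG : G.Connected) (hc : IsOnlyCycle c)
    (hleaf : ∀ x, IsLeaf G x → Even (distTo c x)) {x : V} (hx : Odd (distTo c x)) :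
    ∃ y, G.Adj x y ∧ distTo c y = distTo c x + 1 := by
  have hx0 : distTo c x ≠ 0 := by
    intro h
    rw [h] at hx
    simp at hx
  obtain ⟨z, hz, hzx⟩ := exists_adj_distTo_add_one hG c hx0
  have hnl : ¬ IsLeaf G x := fun h => Nat.not_even_iff_odd.2 hx (hleaf x h)
  obtain ⟨y, hy, hyz⟩ : ∃ y, G.Adj x y ∧ y ≠ z := by
    by_contra! hcon
    exact hnl ⟨z, hz, hcon⟩
  refine ⟨y, hy, ?_⟩
  have h1 := distTo_le_add_one hG c hy.symm
  by_contra hne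
  exact hyz (hc.eq_of_distTo_le hG hx0 hy hz (by omega) (by omega))

/-- The periodic enumeration of the vertices of a closed walk. -/
def enumerate (c : G.Walk v v) (j : ℕ) : V := c.getVert (j % c.length)

/-- The index `c.length` is allowed because the walk is closed; this covers the last edge. -/
theorem enumerate_of_le (c : G.Walk v v) {j : ℕ} (hj : j ≤ c.length) :
    enumerate c j = c.getVert j := by
  rcases hj.lt_or_eq with h | h
  · rw [enumerate, Nat.mod_eq_of_lt h]
  · rw [h, enumerate, Nat.mod_self, c.getVert_length, c.getVert_zero]

theorem isCyclicEnum_enumerate (hc : c.IsCycle) : IsCyclicEnum G c.length (enumerate c) where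
  three_le := hc.three_le_length
  adj j := by
    have h0 : j % c.length < c.length := Nat.mod_lt _ (by have := hc.three_le_length; omega)
    have h1 : enumerate c (j + 1) = c.getVert (j % c.length + 1) := by
      rw [← enumerate_of_le c (Nat.succ_le_of_lt h0), enumerate, enumerate]
      congr 1
      simp [Nat.add_mod]
    rw [h1]
    exact c.adj_getVert_succ h0
  eq_iff i j := by
    have hk : 0 < c.length := by have := hc.three_le_length; omega
    constructor
    · intro h
      have h1 := Nat.mod_lt i hk
      have h2 := Nat.mod_lt j hk
      exact hc.getVert_injOn' (by simp only [Set.mem_ofPred_eq]; omega)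
        (by simp only [Set.mem_ofPred_eq]; omega) h
    · intro h
      exact congrArg c.getVert h

theorem mem_support_iff_enumerate (c : G.Walk v v) (x : V) :
    x ∈ c.support ↔ ∃ j, enumerate c j = x := by
  constructor
  · intro h
    obtain ⟨j, hj, hle⟩ := SimpleGraph.Walk.mem_support_iff_exists_getVert.1 h
    exact ⟨j, by rw [enumerate_of_le c hle, hj]⟩
  · rintro ⟨j, rfl⟩
    exact c.getVert_mem_support _

theorem mem_edges_iff_enumerate (c : G.Walk v v) (e : Sym2 V) :
    e ∈ c.edges ↔ ∃ j < c.length, e = s(enumerate c j, enumerate c (j + 1)) := by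
  induction e with
  | h x y =>
    rw [SimpleGraph.Walk.mk_mem_edges_iff_exists]
    constructor
    · rintro ⟨j, hj, h⟩
      exact ⟨j, hj, by rw [enumerate_of_le c hj.le, enumerate_of_le c hj]; exact h.symm⟩
    · rintro ⟨j, hj, h⟩
      rw [enumerate_of_le c hj.le, enumerate_of_le c hj] at h
      exact ⟨j, hj, h.symm⟩

end Distance

/-- Otherwise the component of `v` is a proper set with no nonzero entry leaving it. -/
theorem connected_graph {P : SignPattern n} (hirr : P.IsIrreducible) (hsymm : P.IsCombSymmetric)
    (v : Fin n) : P.graph.Connected := by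
  classical
  have key : ∀ j, P.graph.Reachable v j := by
    set S : Finset (Fin n) := Finset.univ.filter fun j => P.graph.Reachable v j with hS
    by_contra! hcon
    obtain ⟨j, hj⟩ := hcon
    obtain ⟨a, ha, b, hb, hab⟩ := hirr S ⟨v, by simp [hS]⟩ (by
      intro h
      have : j ∈ S := h ▸ Finset.mem_univ j
      exact hj (Finset.mem_filter.1 this).2)
    have hadj : P.graph.Adj a b :=
      ⟨fun h => hb (h ▸ ha), mul_ne_zero hab ((hsymm a b).1 hab)⟩
    exact hb (Finset.mem_filter.2
      ⟨Finset.mem_univ _, (Finset.mem_filter.1 ha).2.trans hadj.reachable⟩)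
  have : Nonempty (Fin n) := ⟨v⟩
  exact ⟨fun a b => (key a).symm.trans (key b)⟩

theorem exists_isCycleMatching {G : SimpleGraph (Fin n)} (hG : G.Connected) {v : Fin n}
    {c : G.Walk v v} (hc : IsOnlyCycle c) (hleaf : ∀ x, IsLeaf G x → Even (distTo c x)) :
    ∃ O m, IsCycleMatching G c.length (enumerate c) O m := by
  classical
  have hch : ∀ x, Odd (distTo c x) → ∃ y, G.Adj x y ∧ distTo c y = distTo c x + 1 :=
    fun x hx => hc.exists_child hG hleaf hx
  choose! m hadj hdist using hch
  have h0 : ∀ l, distTo c (enumerate c l) = 0 := fun l =>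
    (distTo_eq_zero_iff hG c _).2 ((mem_support_iff_enumerate c _).2 ⟨l, rfl⟩)
  refine ⟨Finset.univ.filter fun x => Odd (distTo c x), m, isCyclicEnum_enumerate hc.1,
    ⟨?_, ?_, ?_⟩, ?_, ?_, ?_⟩
  · intro x hx
    exact hadj x (Finset.mem_filter.1 hx).2
  · intro x hx y hy hxy
    have hx := (Finset.mem_filter.1 hx).2
    have hy := (Finset.mem_filter.1 hy).2
    have h1 := hdist x hx
    have h2 := hdist y hy
    have h3 := hadj y hy
    rw [← hxy] at h2 h3
    -- Both `x` and `y` are neighbours of `m x` nearer to the cycle.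
    exact hc.eq_of_distTo_le hG (x := m x) (by omega) (hadj x hx).symm h3.symm (by omega)
      (by omega)
  · intro x hx hmx
    have hx := (Finset.mem_filter.1 hx).2
    have hmx := (Finset.mem_filter.1 hmx).2
    rw [hdist x hx, Nat.odd_add_one] at hmx
    exact hmx hx
  · rintro x hx l rfl
    have hx := (Finset.mem_filter.1 hx).2
    rw [h0] at hx
    simp at hx
  · intro x hx l h
    have h1 := hdist x (Finset.mem_filter.1 hx).2
    rw [← h, h0] at h1
    omega
  · intro x y hxy
    by_cases hx : distTo c x = 0
    · exact Or.inr (Or.inr ((mem_support_iff_enumerate c _).1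
        ((distTo_eq_zero_iff hG c x).1 hx)))
    · rcases hc.odd_or_odd_of_adj hG hxy hx with h | h
      · exact Or.inl (by simpa using h)
      · exact Or.inr (Or.inl (by simpa using h))

/-- If the edges agreed with reversed orientation, `k` would divide `2`. -/
theorem IsCyclicEnum.edge_injOn {V : Type*} {G : SimpleGraph V} {k : ℕ} {u : ℕ → V}
    (hu : IsCyclicEnum G k u) {i j : ℕ} (hi : i < k) (hj : j < k)
    (h : s(u i, u (i + 1)) = s(u j, u (j + 1))) : i = j := by
  rcases Sym2.eq_iff.1 h with ⟨h1, -⟩ | ⟨h1, h2⟩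
  · exact hu.injOn hi hj h1
  · have h3 : i + 2 ≡ i + 0 [MOD k] :=
      (((hu.eq_iff _ _).1 h2).add_right 1).trans ((hu.eq_iff _ _).1 h1).symm
    have h4 := (Nat.modEq_zero_iff_dvd.1 (Nat.ModEq.add_left_cancel' i h3))
    have := Nat.le_of_dvd (by norm_num) h4
    have := hu.three_le
    omega

/-! ### Maximal signed paths and case (ii). -/

section SignedPath

variable {P : SignPattern n} {v : Fin n} {c : P.graph.Walk v v} {k : ℕ} {u : ℕ → Fin n}

/-- When the edges of sign `σ` form a single interval of indices, maximality propagates from one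
edge of `p` to its neighbours in both directions until the whole interval is covered. -/
theorem length_eq_of_sign_interval (hu : IsCyclicEnum P.graph k u)
    (hE : ∀ e, e ∈ c.edges ↔ ∃ j, e = s(u j, u (j + 1))) {a b : Fin n} {p : P.graph.Walk a b}
    (hp : p.IsPath) (hlen : 0 < p.length) (hpc : ∀ e ∈ p.edges, e ∈ c.edges) {σ : SignType}
    (hpσ : ∀ e ∈ p.edges, P.edgeSign e = σ)
    (hmax : ∀ e ∈ c.edges, e ∉ p.edges → (∃ x ∈ p.support, x ∈ e) → P.edgeSign e ≠ σ)
    {lo hi : ℕ} (hhi : hi ≤ k)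
    (hin : ∀ j, lo ≤ j → j < hi → P.edgeSign s(u j, u (j + 1)) = σ)
    (hout : ∀ j < k, P.edgeSign s(u j, u (j + 1)) = σ → lo ≤ j ∧ j < hi) :
    p.length = hi - lo := by
  classical
  have hedge : ∀ e ∈ p.edges, ∃ j < k, e = s(u j, u (j + 1)) := by
    intro e he
    obtain ⟨j, rfl⟩ := (hE e).1 (hpc e he)
    obtain ⟨i, hi, hij⟩ := hu.exists_lt j
    exact ⟨i, hi, by rw [hij, hu.succ_eq hij]⟩
  obtain ⟨e₀, he₀⟩ : ∃ e, e ∈ p.edges :=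
    List.exists_mem_of_length_pos (by rwa [SimpleGraph.Walk.length_edges])
  obtain ⟨j₀, hj₀, rfl⟩ := hedge e₀ he₀
  obtain ⟨hlo₀, hhi₀⟩ := hout j₀ hj₀ (hpσ _ he₀)
  have hup : ∀ j, s(u j, u (j + 1)) ∈ p.edges → lo ≤ j + 1 → j + 1 < hi →
      s(u (j + 1), u (j + 1 + 1)) ∈ p.edges := by
    intro j hj h1 h2
    by_contra hcon
    exact hmax _ ((hE _).2 ⟨j + 1, rfl⟩) hcon
      ⟨u (j + 1), p.snd_mem_support_of_mem_edges hj, Sym2.mem_mk_left _ _⟩ (hin _ h1 h2)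
  have hdown : ∀ j, s(u (j + 1), u (j + 1 + 1)) ∈ p.edges → lo ≤ j → j < hi →
      s(u j, u (j + 1)) ∈ p.edges := by
    intro j hj h1 h2
    by_contra hcon
    exact hmax _ ((hE _).2 ⟨j, rfl⟩) hcon
      ⟨u (j + 1), p.fst_mem_support_of_mem_edges hj, Sym2.mem_mk_right _ _⟩ (hin _ h1 h2)
  have hall_up : ∀ t, j₀ + t < hi → s(u (j₀ + t), u (j₀ + t + 1)) ∈ p.edges := by
    intro t
    induction t with
    | zero => exact fun _ => he₀
    | succ t ih => exact fun h => hup (j₀ + t) (ih (by omega)) (by omega) h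
  have hall_down : ∀ t i, i + t = j₀ → lo ≤ i → s(u i, u (i + 1)) ∈ p.edges := by
    intro t
    induction t with
    | zero =>
      intro i h _
      obtain rfl : i = j₀ := h
      exact he₀
    | succ t ih =>
      intro i h h1
      exact hdown i (ih (i + 1) (by omega) (by omega)) h1 (by omega)
  have hset : p.edges.toFinset = (Finset.Ico lo hi).image fun j => s(u j, u (j + 1)) := by
    ext e
    rw [List.mem_toFinset, Finset.mem_image]
    constructor
    · intro he
      obtain ⟨j, hj, rfl⟩ := hedge e he
      exact ⟨j, Finset.mem_Ico.2 (hout j hj (hpσ _ he)), rfl⟩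
    · rintro ⟨j, hj, rfl⟩
      rw [Finset.mem_Ico] at hj
      rcases le_total j₀ j with h | h
      · obtain ⟨t, rfl⟩ := Nat.exists_eq_add_of_le h
        exact hall_up t hj.2
      · exact hall_down (j₀ - j) j (by omega) hj.1
  have hcard := congrArg Finset.card hset
  rwa [List.toFinset_card_of_nodup hp.isTrail.edges_nodup, SimpleGraph.Walk.length_edges,
    Finset.card_image_of_injOn, Nat.card_Ico] at hcard
  intro i hi' j hj' hij
  simp only [Finset.coe_Ico, Set.mem_Ico] at hi' hj'
  exact hu.edge_injOn (by omega) (by omega) hij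

theorem length_lt_of_isPath (hu : IsCyclicEnum P.graph k u)
    (hE : ∀ e, e ∈ c.edges ↔ ∃ j, e = s(u j, u (j + 1))) {a b : Fin n} {p : P.graph.Walk a b}
    (hp : p.IsPath) (hlen : 0 < p.length) (hpc : ∀ e ∈ p.edges, e ∈ c.edges) :
    p.length < k := by
  classical
  have hsub : p.support.toFinset ⊆ (Finset.range k).image u := by
    intro x hx
    rw [List.mem_toFinset] at hx
    have hnil : ¬ p.Nil := fun h =>
      hlen.ne' (SimpleGraph.Walk.length_eq_zero_iff.2 h)
    obtain ⟨e, he, hxe⟩ := (SimpleGraph.Walk.mem_support_iff_exists_mem_edges_of_not_nil hnil).1 hx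
    obtain ⟨j, rfl⟩ := (hE e).1 (hpc e he)
    have : ∃ l, u l = x := by
      rcases Sym2.mem_iff.1 hxe with h | h
      · exact ⟨_, h.symm⟩
      · exact ⟨_, h.symm⟩
    obtain ⟨l, rfl⟩ := this
    obtain ⟨i, hi, hil⟩ := hu.exists_lt l
    exact Finset.mem_image.2 ⟨i, Finset.mem_range.2 hi, hil⟩
  have h1 := Finset.card_le_card hsub
  have h2 := Finset.card_image_le (s := Finset.range k) (f := u)
  rw [List.toFinset_card_of_nodup hp.support_nodup, SimpleGraph.Walk.length_support] at h1
  rw [Finset.card_range] at h2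
  omega

theorem IsMaximalSignedPath.sign_eq {a b : Fin n} {p : P.graph.Walk a b} (hlen : 0 < p.length)
    {σ : SignType} (hpσ : ∀ e ∈ p.edges, P.edgeSign e = σ) : σ = 1 ∨ σ = -1 := by
  obtain ⟨e, he⟩ : ∃ e, e ∈ p.edges :=
    List.exists_mem_of_length_pos (by rwa [SimpleGraph.Walk.length_edges])
  rw [← hpσ e he]
  induction e with
  | h x y => exact edgeSign_eq_of_adj P (p.adj_of_mem_edges he)

theorem IsCyclicEnum.edgeSign_eq (hu : IsCyclicEnum P.graph k u) (j : ℕ) :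
    P.edgeSign s(u j, u (j + 1)) = 1 ∨ P.edgeSign s(u j, u (j + 1)) = -1 :=
  edgeSign_eq_of_adj P (hu.adj j)

/-- On an all-negative cycle, maximality would make the path use all `k` edges, but a path has
fewer. -/
theorem IsMaximalSignedPath.exists_pos (hu : IsCyclicEnum P.graph k u)
    (hE : ∀ e, e ∈ c.edges ↔ ∃ j, e = s(u j, u (j + 1))) {a b : Fin n} {p : P.graph.Walk a b}
    (hp : P.IsMaximalSignedPath c p) : ∃ j < k, P.edgeSign s(u j, u (j + 1)) = 1 := by
  obtain ⟨hpath, hlen, hpc, σ, hpσ, hmax⟩ := hp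
  by_contra! hcon
  have hneg : ∀ j, P.edgeSign s(u j, u (j + 1)) = -1 := fun j => by
    obtain ⟨i, hi, hij⟩ := hu.exists_lt j
    rw [← hij, ← hu.succ_eq hij]
    exact (hu.edgeSign_eq i).resolve_left (hcon i hi)
  have hσ : σ = -1 := by
    obtain ⟨e, he⟩ : ∃ e, e ∈ p.edges :=
      List.exists_mem_of_length_pos (by rwa [SimpleGraph.Walk.length_edges])
    obtain ⟨j, rfl⟩ := (hE e).1 (hpc e he)
    rw [← hpσ _ he, hneg]
  have h1 := length_eq_of_sign_interval hu hE hpath hlen hpc hpσ hmax (lo := 0) (hi := k) le_rfl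
    (fun j _ _ => by rw [hneg, hσ]) (fun j hj _ => ⟨Nat.zero_le _, hj⟩)
  have h2 := length_lt_of_isPath hu hE hpath hlen hpc
  omega

variable {O : Finset (Fin n)} {m : Fin n → Fin n}

/-- A third positive edge is disjoint from one of the first two because `k ≥ 4`. Without one, the
maximal signed paths have the even lengths `2` and `k - 2`. -/
theorem IsCycleMatching.not_isConsistent_of_adjacent_pos (h : IsCycleMatching P.graph k u O m)
    (hsymm : P.IsCombSymmetric) (hdiag : P.IsZeroDiagonal) (hk : Even k)
    (hE : ∀ e, e ∈ c.edges ↔ ∃ j, e = s(u j, u (j + 1)))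
    (hp0 : P.edgeSign s(u 0, u 1) = 1) (hp1 : P.edgeSign s(u 1, u 2) = 1)
    {a b : Fin n} {p : P.graph.Walk a b} (hp : P.IsMaximalSignedPath c p)
    (hodd : Odd p.length) : ¬ P.IsConsistent := by
  have hk3 := h.enum.three_le
  have hk4 : 4 ≤ k := by
    obtain ⟨r, hr⟩ := hk
    omega
  by_cases hex : ∃ j, 2 ≤ j ∧ j < k ∧ P.edgeSign s(u j, u (j + 1)) = 1
  · obtain ⟨j, hj2, hjk, hpj⟩ := hex
    by_cases hj : j = k - 1
    · refine h.not_isConsistent_of_two_pos hsymm hdiag (a := 1) (b := j) (by omega) hjk hp1 hpj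
        (fun he => ?_) (fun he => ?_) (fun he => ?_)
      · have := h.enum.injOn (by omega) hjk he
        omega
      · have := h.enum.injOn (by omega) hjk he
        omega
      · have h1 : u (j + 1) = u 0 := by
          rw [← h.enum.add_period 0]
          congr 1
          omega
        have := h.enum.injOn (by omega) (by omega) (h1.symm.trans he)
        omega
    · refine h.not_isConsistent_of_two_pos hsymm hdiag (a := 0) (b := j) (by omega) hjk hp0 hpj
        (fun he => ?_) (fun he => ?_) (fun he => ?_)
      · have := h.enum.injOn (by omega) hjk he
        omega
      · have := h.enum.injOn (by omega) hjk he
        omega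
      · have := h.enum.injOn (by omega) (by omega) he
        omega
  · push Not at hex
    exfalso
    obtain ⟨hpath, hlen, hpc, σ, hpσ, hmax⟩ := hp
    have hpos : ∀ j, j < 2 → P.edgeSign s(u j, u (j + 1)) = 1 := by
      intro j hj
      interval_cases j
      · exact hp0
      · exact hp1
    have hneg : ∀ j, 2 ≤ j → j < k → P.edgeSign s(u j, u (j + 1)) = -1 := fun j h1 h2 =>
      (h.enum.edgeSign_eq j).resolve_left (hex j h1 h2)
    rcases IsMaximalSignedPath.sign_eq hlen hpσ with rfl | rfl
    · have h1 := length_eq_of_sign_interval h.enum hE hpath hlen hpc hpσ hmax (lo := 0) (hi := 2)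
        (by omega) (fun j _ hj => hpos j hj) (fun j hj hs => by
          refine ⟨Nat.zero_le _, ?_⟩
          by_contra hcon
          exact hex j (by omega) hj hs)
      rw [h1] at hodd
      exact absurd hodd (by decide)
    · have h1 := length_eq_of_sign_interval h.enum hE hpath hlen hpc hpσ hmax (lo := 2) (hi := k)
        le_rfl hneg (fun j hj hs => by
          refine ⟨?_, hj⟩
          by_contra hcon
          rw [hpos j (by omega)] at hs
          exact absurd hs (by decide))
      rw [h1] at hodd
      obtain ⟨r, hr⟩ := hk
      obtain ⟨q, hq⟩ := hodd
      omega

theorem mem_edges_iff_shift (hu : IsCyclicEnum P.graph k u)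
    (hE : ∀ e, e ∈ c.edges ↔ ∃ j, e = s(u j, u (j + 1))) (a : ℕ) (e : Sym2 (Fin n)) :
    e ∈ c.edges ↔ ∃ j, e = s(u (j + a), u (j + 1 + a)) := by
  rw [hE]
  constructor
  · rintro ⟨j, rfl⟩
    -- Adding `a` full turns keeps the subtraction of `a` in the natural numbers.
    have hle : a ≤ j + a * k := by nlinarith [hu.three_le]
    have h1 : u (j + a * k) = u j := (hu.eq_iff _ _).2 (by simp [Nat.ModEq])
    refine ⟨j + a * k - a, ?_⟩
    rw [add_right_comm, Nat.sub_add_cancel hle, hu.succ_eq h1, h1]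
  · rintro ⟨j, rfl⟩
    exact ⟨j + a, by rw [add_right_comm]⟩

theorem IsCycleMatching.not_isConsistent_of_odd_path (h : IsCycleMatching P.graph k u O m)
    (hsymm : P.IsCombSymmetric) (hdiag : P.IsZeroDiagonal)
    (hE : ∀ e, e ∈ c.edges ↔ ∃ j, e = s(u j, u (j + 1)))
    {a b : Fin n} {p : P.graph.Walk a b} (hp : P.IsMaximalSignedPath c p)
    (hodd : Odd p.length) : ¬ P.IsConsistent := by
  obtain ⟨i, hi, hpi⟩ := hp.exists_pos h.enum hE
  rcases Nat.even_or_odd k with hk | hk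
  swap
  · exact h.not_isConsistent_of_odd hsymm hdiag hk hi hpi
  have h' := h.shift i
  have hE' := mem_edges_iff_shift h.enum hE i
  have hk3 := h.enum.three_le
  set w : ℕ → Fin n := fun j => u (j + i) with hw
  have hp0 : P.edgeSign s(w 0, w 1) = 1 := by
    simp only [hw]
    rwa [zero_add, add_comm 1 i]
  -- Starting from a positive edge of index `0`, either all odd edges are negative or a positive odd
  -- edge exists, which is disjoint from edge `0` unless its index is `1` or `k - 1`.
  by_cases hex : ∃ j < k, Odd j ∧ P.edgeSign s(w j, w (j + 1)) = 1
  swap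
  · push Not at hex
    exact h'.not_isConsistent_of_neg_class hsymm hdiag hk hp0 fun j hj hjo =>
      (h'.enum.edgeSign_eq j).resolve_left (hex j hj hjo)
  obtain ⟨j, hjk, hjo, hpj⟩ := hex
  by_cases hj1 : j = 1
  · subst hj1
    exact h'.not_isConsistent_of_adjacent_pos hsymm hdiag hk hE' hp0 hpj hp hodd
  by_cases hjl : j = k - 1
  -- Rotating once more turns the positive edges `k - 1` and `0` into edges `0` and `1`.
  · refine (h'.shift j).not_isConsistent_of_adjacent_pos hsymm hdiag hk
      (mem_edges_iff_shift h'.enum hE' j) ?_ ?_ hp hodd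
    · rwa [zero_add, add_comm 1 j]
    · have h1 : w (1 + j) = w 0 := by
        rw [← h'.enum.add_period 0]
        congr 1
        omega
      have h2 : w (2 + j) = w 1 := by
        rw [← h'.enum.add_period 1]
        congr 1
        omega
      rwa [h1, h2]
  have hj0 : j ≠ 0 := by
    rintro rfl
    simp at hjo
  refine h'.not_isConsistent_of_two_pos hsymm hdiag (a := 0) (b := j) (by omega) hjk hp0 hpj
    (fun he => ?_) (fun he => ?_) (fun he => ?_)
  · exact hj0 (h'.enum.injOn (by omega) hjk he).symm
  · exact hj1 (h'.enum.injOn (by omega) hjk he).symm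
  · have := h'.enum.injOn (by omega) (by omega) he
    omega

end SignedPath

end SignPattern

theorem theorem4p4 {n : ℕ} (P : SignPattern n) (hirr : SignPattern.IsIrreducible P)
    (hsymm : P.IsCombSymmetric) (hdiag : P.IsZeroDiagonal)
    {v : Fin n} (c : P.graph.Walk v v) (hc : SignPattern.IsOnlyCycle c)
    (hleaf : ∀ x, SignPattern.IsLeaf P.graph x → Even (SignPattern.distTo c x))
    (h : P.HasTwoNonadjacentPosEdges c ∨ P.HasTwoOddMaximalSignedPaths c ∨
      (Odd c.length ∧ P.HasPosEdge c)) :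
    ¬ P.IsConsistent := by
  obtain ⟨O, m, hD⟩ :=
    SignPattern.exists_isCycleMatching (SignPattern.connected_graph hirr hsymm v) hc hleaf
  have hE := SignPattern.mem_edges_iff_enumerate c
  rcases h with ⟨e, he, f, hf, hef, hpe, hpf⟩ | ⟨_, _, _, _, p, _, hp, -, hodd, -⟩ |
    ⟨hk, e, he, hpe⟩
  · obtain ⟨a, ha, rfl⟩ := (hE e).1 he
    obtain ⟨b, hb, rfl⟩ := (hE f).1 hf
    refine hD.not_isConsistent_of_two_pos hsymm hdiag ha hb hpe hpf
      (fun h => ?_) (fun h => ?_) (fun h => ?_)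
    · exact hef _ ⟨Sym2.mem_mk_left _ _, h ▸ Sym2.mem_mk_left _ _⟩
    · exact hef _ ⟨Sym2.mem_mk_right _ _, h ▸ Sym2.mem_mk_left _ _⟩
    · exact hef _ ⟨Sym2.mem_mk_left _ _, h ▸ Sym2.mem_mk_right _ _⟩
  · refine hD.not_isConsistent_of_odd_path hsymm hdiag (fun e => (hE e).trans ⟨?_, ?_⟩) hp hodd
    · rintro ⟨j, -, hj⟩
      exact ⟨j, hj⟩
    · rintro ⟨j, rfl⟩
      obtain ⟨i, hi, hij⟩ := hD.enum.exists_lt j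
      exact ⟨i, hi, by rw [hij, hD.enum.succ_eq hij]⟩
  · obtain ⟨a, ha, rfl⟩ := (hE e).1 he
    exact hD.not_isConsistent_of_odd hsymm hdiag hk ha hpe
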